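/- **Setting.** Let $\mathbb{P}$ be a pushdown system with finite sets of control states $\mathcal P$ and stack symbols $\Gamma$, where $\bot\in\Gamma$ marks the bottom of the stack. A command $(p,a,p',u)$ with $|u|\le 2$ gives the transitions $\langle p,aw\rangle\hookrightarrow\langle p',uw\rangle$; $\bot$ is never pushed or popped. Stacks are the words in $(\Gamma\setminus\{\bot\})^*\bot$; the set of configurations is $\mathcal C=\mathcal P\times(\Gamma\setminus\{\bot\})^*\bot$. Formulas are $\varphi ::= x\mid\neg x\mid Z\mid\varphi\wedge\varphi\mid\varphi\vee\varphi\mid\Box\varphi\mid\Diamond\varphi\mid\overline\Box\varphi\mid\overline\Diamond\varphi\mid\mu Z.\varphi\mid\nu Z.\varphi$, each variable being bound at most once and none being both free and bound. For an environment $\rho$ of the propositions and a valuation $V$ of the variables by subsets of $\mathcal C$, $[\![\varphi]\!]_V\subseteq\mathcal C$ is the usual denotation over the graph $(\mathcal C,\hookrightarrow)$, where $\overline\Box,\overline\Diamond$ quantify over predecessors. **Automata.** An alternating automaton has transitions $(q,a,Q)$ with $Q$ a finite set of states: reading $a$ in $q$, it continues from all states of $Q$. There are states $q^*$, accepting exactly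 the stacks, and $q^\varepsilon_f$, the only final state, without outgoing transitions. A valuation $T$ assigns to each state a set of stacks, except that $T(q^\varepsilon_f)=\{\varepsilon\}$, and $T(q^*)$ is the set of all stacks. An automaton is *$T$-sound* if for all its transitions $(q,a,Q)$ and all words $w$: if $w\in T(q')$ for all $q'\in Q$, then $aw\in T(q)$. **Algorithm.** The algorithm takes an automaton $A$ with finitely many states, all of level $<c$, a formula $\varphi$ and a level $c$, and returns an automaton $A'$ with initial states $I_\varphi(p)$, $p\in\mathcal P$. Literals $x,\neg x$ and variables $Z$ are represented by states $(p,x,0)$, $(p,\neg x,0)$ and $(p,Z,\ell(Z))$, where $\ell(Z)<c$ for each free variable $Z$ of $\varphi$; for these formulas $A'=A$ and $I_\varphi(p)$ is the state named. Otherwise $I_\varphi(p)=(p,\varphi,c)$, except that $I_\varphi(p)=(p,Z,c)$ for $\varphi=\sigma Z.\varphi_1$, $\sigma\in\{\mu,\nu\}$. For a connective, the algorithm first calls itself on $A$ and the immediate subformulas $\varphi_i$ at level $c$; let $I_i(p)$ be the initial states returned. To the union of the results it adds the following transitions. Runs $\xrightarrow{u}$ are runs of the automaton returned by the recursive call, "$\bigcup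 Q_j$" ranges over all choices of such runs, and "$(p',a')\to pu$" abbreviates that $(p',a',p,u)$ is a command. - $\varphi_1\wedge\varphi_2$: $(I(p),a,Q_1\cup Q_2)$ for transitions $(I_i(p),a,Q_i)$. $\varphi_1\vee\varphi_2$: $(I(p),a,Q)$ for each transition $(I_1(p),a,Q)$ or $(I_2(p),a,Q)$. - $\Diamond\varphi_1$: $(I(p),a,Q)$ for a command $(p,a,p',u)$ and a run $I_1(p')\xrightarrow{u}Q$. $\Box\varphi_1$: $(I(p),a,\bigcup_j Q_j)$ for runs $I_1(p_j)\xrightarrow{u_j}Q_j$, one for each command $(p,a,p_j,u_j)$, if there is one; if there is none, $(I(p),a,\{q^*\})$ for $a\ne\bot$ and $(I(p),\bot,\{q^\varepsilon_f\})$ for $a=\bot$. - $\overline\Box\varphi_1$, with extra states $(p,\varphi,c,a)$ for $a\neq\bot$, and $(p,\varphi,c,\bot):=q^\varepsilon_f$: (i) $(I(p),a,\{(p,\varphi,c,a)\}\cup\bigcup_j Q_j\cup\bigcup_k R_k)$ for runs $I_1(p_j)\xrightarrow{a_ja}Q_j$, one for each $(p_j,a_j)\to p\varepsilon$, and $I_1(p_k')\xrightarrow{a_k'}R_k$,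 one for each $(p'_k,a'_k)\to pa$; (ii) for $a\ne\bot$, $((p,\varphi,c,a),b,\bigcup_jQ_j)$ for runs $I_1(p_j)\xrightarrow{a_j}Q_j$, one for each $(p_j,a_j)\to pab$, if there is one; if there is none, $((p,\varphi,c,a),b,\{q^*\})$ for $b\neq\bot$ and $((p,\varphi,c,a),\bot,\{q^\varepsilon_f\})$ for $b=\bot$; (iii) if no command $(p',a')\to pu$ has $u\in\{\varepsilon,a\}\cup a\Gamma$: $(I(p),a,\{q^*\})$ for $a\ne\bot$ and $(I(p),\bot,\{q^\varepsilon_f\})$ for $a=\bot$. - $\overline\Diamond\varphi_1$, with extra states $(p,\varphi,c,a)$ for $a\neq\bot$: $(I(p),a,Q)$ for $(p',a')\to p\varepsilon$ and $I_1(p')\xrightarrow{a'a}Q$, or for $(p',a')\to pa$ and $I_1(p')\xrightarrow{a'}Q$; and, for $a\neq\bot$, $(I(p),a,\{(p,\varphi,c,a)\})$, and $((p,\varphi,c,a),b,Q)$ for $(p',a')\to pab$ and $I_1(p')\xrightarrow{a'}Q$. - $\sigma Z.\varphi_1$: $A_0$ is $A$ with new states $(p,Z,c)$, which accept nothing if $\sigma=\mu$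 and, through $((p,Z,c),a,\{q^*\})$, $a\neq\bot$, and $((p,Z,c),\bot,\{q^\varepsilon_f\})$, all stacks if $\sigma=\nu$. From $A_i$, a call for $\varphi_1$ at level $c+1$ with $\ell(Z)=c$ gives $B_i$ with initial states $I_1(p)$. $A_{i+1}$ consists of $A$, of the transitions of $B_i$ from level-$(c+1)$ states, and of a transition $((p,Z,c),a,Q)$ for each $(I_1(p),a,Q)$ in $B_i$, where in all these new transitions level $c+1$ is renamed to $c$. The loop returns $A_{n+1}$ for an $n$ with $A_n\preceq A_{n+1}\preceq A_n$ (for example $A_n=A_{n+1}$), where $A\preceq B$ if each transition $(q,a,Q)$ of $A$ has a counterpart $(q,a,Q')$ in $B$ with $Q'\subseteq Q$, or with $Q'\subseteq Q\cup\{q^*\}$ and $Q\not\subseteq\{q^\varepsilon_f\}$. **Updated valuation.** Suppose that $T$ represents $\rho$ and $V$: for all $p$ and $x$, $T(p,x,0)=\{w:\langle p,w\rangle\in\rho(x)\}$ and $T(p,\neg x,0)=\{w:\langle p,w\rangle\in\mathcal C\setminus\rho(x)\}$, and $T(p,Z,\ell(Z))=\{w:\langle p,w\rangle\in V(Z)\}$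 for each free variable $Z$ of $\varphi$. Then $V^c_\varphi$ is $T$, changed at the following states of level $c$: for each subformula $\psi$ of $\varphi$ that is neither a literal, a variable nor a fixed-point formula, $V^c_\varphi(p,\psi,c)=\{w:\langle p,w\rangle\in[\![\psi]\!]\}$; for each fixed-point subformula $\sigma Z.\psi$, $V^c_\varphi(p,Z,c)=\{w:\langle p,w\rangle\in[\![\sigma Z.\psi]\!]\}$; and for each subformula $\overline\Box\psi$ (respectively $\overline\Diamond\psi$), $V^c_\varphi(p,\overline\Box\psi,c,a)$ (respectively $V^c_\varphi(p,\overline\Diamond\psi,c,a)$) is the set of stacks $w$ such that for all (respectively some) $b,v$ with $w=bv$ and $(p',a')\to pab$, $\langle p',a'v\rangle\in[\![\psi]\!]$. Denotations are taken under $V$, where each variable bound in $\varphi$ around the subformula stands for the denotation of its fixed point. **Lemma (Valuation soundness).** If $A$ is $T$-sound and the algorithm, called with $A$, $\varphi$, $c$, returns $A'$, then $A'$ is $V^c_\varphi$-sound. Moreover $V^c_\varphi(I_\varphi(p))=\{w:\langle p,w\rangle\in[\![\varphi]\!]_V\}$ for all $p$, so that $\langle p,w\rangle\in[\![\varphi]\!]_V$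 whenever $A'$ accepts $w$ from $I_\varphi(p)$. -/

import Mathlib

namespace BackMu

/-! ## Formulas -/

/-- Formulas of the modal mu-calculus with backwards modalities, in positive form. -/
inductive Formula (AP Var : Type*) where
  | atom (x : AP)
  | natom (x : AP)
  | var (Z : Var)
  | and (φ ψ : Formula AP Var)
  | or (φ ψ : Formula AP Var)
  | box (φ : Formula AP Var)
  | dia (φ : Formula AP Var)
  | bbox (φ : Formula AP Var)
  | bdia (φ : Formula AP Var)
  | mu (Z : Var) (φ : Formula AP Var)
  | nu (Z : Var) (φ : Formula AP Var)

namespace Formula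

variable {AP Var : Type*}

/-- The free variables. -/
def free : Formula AP Var → Set Var
  | atom _ => ∅
  | natom _ => ∅
  | var Z => {Z}
  | and φ ψ => φ.free ∪ ψ.free
  | or φ ψ => φ.free ∪ ψ.free
  | box φ => φ.free
  | dia φ => φ.free
  | bbox φ => φ.free
  | bdia φ => φ.free
  | mu Z φ => φ.free \ {Z}
  | nu Z φ => φ.free \ {Z}

/-- The variables that are bound by some fixed-point operator of the formula. -/
def bound : Formula AP Var → Set Var
  | atom _ => ∅
  | natom _ => ∅
  | var _ => ∅
  | and φ ψ => φ.bound ∪ ψ.bound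
  | or φ ψ => φ.bound ∪ ψ.bound
  | box φ => φ.bound
  | dia φ => φ.bound
  | bbox φ => φ.bound
  | bdia φ => φ.bound
  | mu Z φ => insert Z φ.bound
  | nu Z φ => insert Z φ.bound

/-- Two formulas whose bound variables are disjoint, and where no variable is bound in one of
them and free in the other. -/
def Apart (φ ψ : Formula AP Var) : Prop :=
  Disjoint φ.bound ψ.bound ∧ Disjoint φ.bound ψ.free ∧ Disjoint φ.free ψ.bound

/-- The usual naming convention: every variable is bound at most once, and no variable occurs
both free and bound. -/
def WellNamed : Formula AP Var → Prop
  | atom _ => True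
  | natom _ => True
  | var _ => True
  | and φ ψ => φ.WellNamed ∧ ψ.WellNamed ∧ φ.Apart ψ
  | or φ ψ => φ.WellNamed ∧ ψ.WellNamed ∧ φ.Apart ψ
  | box φ => φ.WellNamed
  | dia φ => φ.WellNamed
  | bbox φ => φ.WellNamed
  | bdia φ => φ.WellNamed
  | mu Z φ => φ.WellNamed ∧ Z ∉ φ.bound
  | nu Z φ => φ.WellNamed ∧ Z ∉ φ.bound

end Formula

/-! ## Pushdown systems and the denotation of formulas -/

/-- A pushdown system with control states `P` and stack alphabet `Γ` (which contains the
bottom-of-stack symbol `bot`). A rule `(p, a, p', u)` replaces the top symbol `a` by the word `u`.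
Rules pop, rewrite or push, and the bottom symbol is neither pushed nor popped. -/
structure PDS (P Γ : Type*) where
  bot : Γ
  rules : Set (P × Γ × P × List Γ)
  short : ∀ p a p' u, (p, a, p', u) ∈ rules → u.length ≤ 2
  bot_kept : ∀ p p' u, (p, bot, p', u) ∈ rules → ∃ v : List Γ, u = v ++ [bot] ∧ bot ∉ v
  bot_not_made : ∀ p a p' u, (p, a, p', u) ∈ rules → a ≠ bot → bot ∉ u

namespace PDS

variable {P Γ : Type*} (M : PDS P Γ)

/-- The stacks: words over the alphabet without `bot`, followed by one `bot`. -/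
def stackWords : Set (List Γ) := {w | ∃ v : List Γ, w = v ++ [M.bot] ∧ M.bot ∉ v}

/-- The configurations: a control state and a stack. -/
def configs : Set (P × List Γ) := {k | k.2 ∈ M.stackWords}

/-- The transition relation of the configuration graph. -/
def Step (k k' : P × List Γ) : Prop :=
  ∃ a u w, (k.1, a, k'.1, u) ∈ M.rules ∧ k.2 = a :: w ∧ k'.2 = u ++ w

/-- The commands that apply to head `(p, a)`. -/
def next (p : P) (a : Γ) : Set (P × List Γ) := {x | (p, a, x.1, x.2) ∈ M.rules}

/-- Heads of the pop commands that lead to `p`. -/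
def prePop (p : P) : Set (P × Γ) := {x | (x.1, x.2, p, []) ∈ M.rules}

/-- Heads of the commands that rewrite the top symbol to `a` and lead to `p`. -/
def preRew (p : P) (a : Γ) : Set (P × Γ) := {x | (x.1, x.2, p, [a]) ∈ M.rules}

/-- Heads of the commands that replace the top symbol by `a b` and lead to `p`. -/
def prePush (p : P) (a b : Γ) : Set (P × Γ) := {x | (x.1, x.2, p, [a, b]) ∈ M.rules}

/-- All of them. -/
def pre (p : P) (a b : Γ) : Set (P × Γ) := M.prePop p ∪ M.preRew p a ∪ M.prePush p a b

end PDS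

section Denotation

variable {P Γ AP Var : Type*} [DecidableEq Var]

/-- The denotation of a formula over the configuration graph of `M`, under the environment `ρ`
of the propositions and the valuation `V` of the variables. -/
def den (M : PDS P Γ) (ρ : AP → Set (P × List Γ)) :
    (Var → Set (P × List Γ)) → Formula AP Var → Set (P × List Γ)
  | _, .atom x => ρ x
  | _, .natom x => M.configs \ ρ x
  | V, .var Z => V Z
  | V, .and φ ψ => den M ρ V φ ∩ den M ρ V ψ
  | V, .or φ ψ => den M ρ V φ ∪ den M ρ V ψ
  | V, .box φ => {k ∈ M.configs | ∀ k' ∈ M.configs, M.Step k k' → k' ∈ den M ρ V φ}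
  | V, .dia φ => {k ∈ M.configs | ∃ k' ∈ M.configs, M.Step k k' ∧ k' ∈ den M ρ V φ}
  | V, .bbox φ => {k ∈ M.configs | ∀ k' ∈ M.configs, M.Step k' k → k' ∈ den M ρ V φ}
  | V, .bdia φ => {k ∈ M.configs | ∃ k' ∈ M.configs, M.Step k' k ∧ k' ∈ den M ρ V φ}
  | V, .mu Z φ => ⋂₀ {S | S ⊆ M.configs ∧ den M ρ (Function.update V Z S) φ ⊆ S}
  | V, .nu Z φ => ⋃₀ {S | S ⊆ M.configs ∧ S ⊆ den M ρ (Function.update V Z S) φ}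

end Denotation

/-! ## Alternating automata over stacks -/

/-- Automaton states: `top` (written `q*`, for the set of all stacks), `fin` (written `q^ε_f`, for
the empty word), the states `(p, φ, c)` and `(p, φ, c, a)` of the algorithm, where `c` is the
level, and any further states `aux e` that the automaton given at the start may use. -/
inductive State (P Γ AP Var E : Type*) where
  | top
  | fin
  | form (p : P) (φ : Formula AP Var) (c : ℕ)
  | int (p : P) (φ : Formula AP Var) (c : ℕ) (a : Γ)
  | aux (e : E)

namespace State

variable {P Γ AP Var E : Type*}

def level : State P Γ AP Var E → ℕ
  | top => 0
  | fin => 0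
  | form _ _ c => c
  | int _ _ c _ => c
  | aux _ => 0

/-- The projection that renames the states of level `c + 1` to level `c`. -/
def proj (c : ℕ) : State P Γ AP Var E → State P Γ AP Var E
  | form p φ d => form p φ (if d = c + 1 then c else d)
  | int p φ d a => int p φ (if d = c + 1 then c else d) a
  | q => q

end State

/-- An alternating automaton; the transition `(q, a, Q)` reads `a` in state `q` and continues from
all states of `Q`. -/
structure Aut (P Γ AP Var E : Type*) where
  states : Set (State P Γ AP Var E)
  trans : Set (State P Γ AP Var E × Γ × Set (State P Γ AP Var E))
  final : Set (State P Γ AP Var E)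

namespace Aut

variable {P Γ AP Var E : Type*}

/-- One step from a set of states: one transition for each state, and the union of their
targets. -/
def StepSet (A : Aut P Γ AP Var E) (Q : Set (State P Γ AP Var E)) (a : Γ)
    (Q' : Set (State P Γ AP Var E)) : Prop :=
  ∃ g : State P Γ AP Var E → Set (State P Γ AP Var E),
    (∀ q ∈ Q, (q, a, g q) ∈ A.trans) ∧ Q' = ⋃ q ∈ Q, g q

/-- A run from a set of states over a word. -/
def RunSet (A : Aut P Γ AP Var E) :
    Set (State P Γ AP Var E) → List Γ → Set (State P Γ AP Var E) → Prop
  | Q, [], Q' => Q' = Q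
  | Q, a :: w, Q' => ∃ R, A.StepSet Q a R ∧ RunSet A R w Q'

/-- A run from a single state. -/
def Run (A : Aut P Γ AP Var E) (q : State P Γ AP Var E) (w : List Γ)
    (Q : Set (State P Γ AP Var E)) : Prop :=
  A.RunSet {q} w Q

/-- Acceptance of a word from a state. -/
def Accepts (A : Aut P Γ AP Var E) (q : State P Γ AP Var E) (w : List Γ) : Prop :=
  ∃ Q, A.Run q w Q ∧ Q ⊆ A.final

/-- `Below Q' Q`, written `Q' ≪ Q`: up to the state `q*`, the set `Q'` is contained in `Q`. -/
def Below (Q' Q : Set (State P Γ AP Var E)) : Prop :=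
  ∀ q ∈ Q', q ∈ Q ∨ (q = .top ∧ ∃ r ∈ Q, r ≠ .fin)

/-- `A ⪯ B`: each transition of `A` has a counterpart in `B` with a smaller target. -/
def Le (A B : Aut P Γ AP Var E) : Prop :=
  ∀ q a Q, (q, a, Q) ∈ A.trans → ∃ Q', (q, a, Q') ∈ B.trans ∧ Below Q' Q

/-- The format of an automaton that is given to the algorithm at level `c`: finitely many states,
all of level below `c`; `q*` accepts exactly the stacks; `q^ε_f` is the only final state and has no
outgoing transitions. -/
structure IsInput (M : PDS P Γ) (c : ℕ) (A : Aut P Γ AP Var E) : Prop where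
  states_finite : A.states.Finite
  top_mem : .top ∈ A.states
  fin_mem : .fin ∈ A.states
  final_eq : A.final = {.fin}
  level_lt : ∀ q ∈ A.states, q.level < c
  trans_mem : ∀ q a Q, (q, a, Q) ∈ A.trans → q ∈ A.states ∧ Q ⊆ A.states
  top_trans : ∀ a Q, (.top, a, Q) ∈ A.trans ↔
    (a ≠ M.bot ∧ Q = {.top}) ∨ (a = M.bot ∧ Q = {.fin})
  fin_trans : ∀ a Q, (.fin, a, Q) ∉ A.trans

end Aut

/-! ## The algorithm -/

section Algorithm

variable {P Γ AP Var E : Type*}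

/-- The initial state `I(p)` of the automaton that the algorithm returns for `φ` at level `c`. The
input automaton represents literals by states of level `0`, and a variable `Z` by the states
`(p, Z, lev Z)`. A fixed point of the variable `Z` is represented by the states `(p, Z, c)`. -/
def init (lev : Var → ℕ) (c : ℕ) (φ : Formula AP Var) (p : P) : State P Γ AP Var E :=
  match φ with
  | .atom x => .form p (.atom x) 0
  | .natom x => .form p (.natom x) 0
  | .var Z => .form p (.var Z) (lev Z)
  | .mu Z _ => .form p (.var Z) c
  | .nu Z _ => .form p (.var Z) c
  | ψ => .form p ψ c

/-- The states `(p, φ, c)` for all control states `p`. -/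
def formStates (φ : Formula AP Var) (c : ℕ) : Set (State P Γ AP Var E) :=
  {q | ∃ p, q = .form p φ c}

/-- The states `(p, φ, c, a)` for all control states `p` and all `a` other than `bot`. -/
def intStates (M : PDS P Γ) (φ : Formula AP Var) (c : ℕ) : Set (State P Γ AP Var E) :=
  {q | ∃ p a, a ≠ M.bot ∧ q = .int p φ c a}

open Classical in
/-- The state `(p, φ, c, a)`, which is `q^ε_f` if `a` is `bot`. -/
noncomputable def intState (M : PDS P Γ) (p : P) (φ : Formula AP Var) (c : ℕ) (a : Γ) :
    State P Γ AP Var E :=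
  if a = M.bot then .fin else .int p φ c a

def andAut (c : ℕ) (φ ψ : Formula AP Var) (A₁ A₂ : Aut P Γ AP Var E)
    (I₁ I₂ : P → State P Γ AP Var E) : Aut P Γ AP Var E where
  states := A₁.states ∪ A₂.states ∪ formStates (.and φ ψ) c
  trans := A₁.trans ∪ A₂.trans ∪
    {t | ∃ p a Q₁ Q₂, (I₁ p, a, Q₁) ∈ A₁.trans ∧ (I₂ p, a, Q₂) ∈ A₂.trans ∧
      t = (.form p (.and φ ψ) c, a, Q₁ ∪ Q₂)}
  final := A₁.final ∪ A₂.final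

def orAut (c : ℕ) (φ ψ : Formula AP Var) (A₁ A₂ : Aut P Γ AP Var E)
    (I₁ I₂ : P → State P Γ AP Var E) : Aut P Γ AP Var E where
  states := A₁.states ∪ A₂.states ∪ formStates (.or φ ψ) c
  trans := A₁.trans ∪ A₂.trans ∪
    {t | ∃ p a Q, ((I₁ p, a, Q) ∈ A₁.trans ∨ (I₂ p, a, Q) ∈ A₂.trans) ∧
      t = (.form p (.or φ ψ) c, a, Q)}
  final := A₁.final ∪ A₂.final

def boxAut (M : PDS P Γ) (c : ℕ) (φ : Formula AP Var) (A₁ : Aut P Γ AP Var E)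
    (I₁ : P → State P Γ AP Var E) : Aut P Γ AP Var E where
  states := A₁.states ∪ formStates (.box φ) c
  trans := A₁.trans ∪
    {t | ∃ p a, ∃ f : P × List Γ → Set (State P Γ AP Var E), (M.next p a).Nonempty ∧
      (∀ x ∈ M.next p a, A₁.Run (I₁ x.1) x.2 (f x)) ∧
      t = (.form p (.box φ) c, a, ⋃ x ∈ M.next p a, f x)} ∪
    {t | ∃ p a, a ≠ M.bot ∧ M.next p a = ∅ ∧ t = (.form p (.box φ) c, a, {.top})} ∪
    {t | ∃ p, M.next p M.bot = ∅ ∧ t = (.form p (.box φ) c, M.bot, {.fin})}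
  final := A₁.final

def diaAut (M : PDS P Γ) (c : ℕ) (φ : Formula AP Var) (A₁ : Aut P Γ AP Var E)
    (I₁ : P → State P Γ AP Var E) : Aut P Γ AP Var E where
  states := A₁.states ∪ formStates (.dia φ) c
  trans := A₁.trans ∪
    {t | ∃ p a Q, ∃ x ∈ M.next p a, A₁.Run (I₁ x.1) x.2 Q ∧ t = (.form p (.dia φ) c, a, Q)}
  final := A₁.final

/-- The backwards box. -/
def bboxAut (M : PDS P Γ) (c : ℕ) (φ : Formula AP Var) (A₁ : Aut P Γ AP Var E)
    (I₁ : P → State P Γ AP Var E) : Aut P Γ AP Var E where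
  states := A₁.states ∪ formStates (.bbox φ) c ∪ intStates M (.bbox φ) c
  trans := A₁.trans ∪
    {t | ∃ p a, ∃ f g : P × Γ → Set (State P Γ AP Var E),
      (∀ x ∈ M.prePop p, A₁.Run (I₁ x.1) [x.2, a] (f x)) ∧
      (∀ x ∈ M.preRew p a, A₁.Run (I₁ x.1) [x.2] (g x)) ∧
      t = (.form p (.bbox φ) c, a,
        {intState M p (.bbox φ) c a} ∪ (⋃ x ∈ M.prePop p, f x) ∪ ⋃ x ∈ M.preRew p a, g x)} ∪
    {t | ∃ p a b, ∃ f : P × Γ → Set (State P Γ AP Var E), a ≠ M.bot ∧ (M.prePush p a b).Nonempty ∧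
      (∀ x ∈ M.prePush p a b, A₁.Run (I₁ x.1) [x.2] (f x)) ∧
      t = (.int p (.bbox φ) c a, b, ⋃ x ∈ M.prePush p a b, f x)} ∪
    {t | ∃ p a, a ≠ M.bot ∧ (∀ b, M.pre p a b = ∅) ∧ t = (.form p (.bbox φ) c, a, {.top})} ∪
    {t | ∃ p, (∀ a, M.pre p M.bot a = ∅) ∧ t = (.form p (.bbox φ) c, M.bot, {.fin})} ∪
    {t | ∃ p a b, a ≠ M.bot ∧ b ≠ M.bot ∧ M.prePush p a b = ∅ ∧
      t = (.int p (.bbox φ) c a, b, {.top})} ∪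
    {t | ∃ p a, a ≠ M.bot ∧ M.prePush p a M.bot = ∅ ∧ t = (.int p (.bbox φ) c a, M.bot, {.fin})}
  final := A₁.final

/-- The backwards diamond. -/
def bdiaAut (M : PDS P Γ) (c : ℕ) (φ : Formula AP Var) (A₁ : Aut P Γ AP Var E)
    (I₁ : P → State P Γ AP Var E) : Aut P Γ AP Var E where
  states := A₁.states ∪ formStates (.bdia φ) c ∪ intStates M (.bdia φ) c
  trans := A₁.trans ∪
    {t | ∃ p a Q, ∃ x ∈ M.prePop p, A₁.Run (I₁ x.1) [x.2, a] Q ∧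
      t = (.form p (.bdia φ) c, a, Q)} ∪
    {t | ∃ p a Q, ∃ x ∈ M.preRew p a, A₁.Run (I₁ x.1) [x.2] Q ∧
      t = (.form p (.bdia φ) c, a, Q)} ∪
    {t | ∃ p a, a ≠ M.bot ∧ t = (.form p (.bdia φ) c, a, {.int p (.bdia φ) c a})} ∪
    {t | ∃ p a b Q, a ≠ M.bot ∧ ∃ x ∈ M.prePush p a b, A₁.Run (I₁ x.1) [x.2] Q ∧
      t = (.int p (.bdia φ) c a, b, Q)}
  final := A₁.final

/-- Start of a least fixed-point computation: the states `(p, Z, c)` accept nothing. -/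
def muStart (c : ℕ) (Z : Var) (A : Aut P Γ AP Var E) : Aut P Γ AP Var E where
  states := A.states ∪ formStates (.var Z) c
  trans := A.trans
  final := A.final

/-- Start of a greatest fixed-point computation: the states `(p, Z, c)` accept all stacks. -/
def nuStart (M : PDS P Γ) (c : ℕ) (Z : Var) (A : Aut P Γ AP Var E) : Aut P Γ AP Var E where
  states := A.states ∪ formStates (.var Z) c
  trans := A.trans ∪
    {t | ∃ p a, a ≠ M.bot ∧ t = (.form p (.var Z) c, a, {.top})} ∪
    {t | ∃ p, t = (.form p (.var Z) c, M.bot, {.fin})}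
  final := A.final

/-- End of one round of a fixed-point computation at level `c`. Here `A` is the input automaton of
the whole computation, and `B` with initial states `I₁` is the result for the body at level `c + 1`.
The states of level `c + 1` of `B` replace those of level `c`, and `(p, Z, c)` takes over the
transitions of `I₁ p`. -/
def nextRound (c : ℕ) (Z : Var) (A B : Aut P Γ AP Var E) (I₁ : P → State P Γ AP Var E) :
    Aut P Γ AP Var E where
  states := A.states ∪ formStates (.var Z) c ∪
    {q | ∃ r ∈ B.states, r.level = c + 1 ∧ q = r.proj c}
  trans := A.trans ∪
    {t | ∃ q a Q, (q, a, Q) ∈ B.trans ∧ q.level = c + 1 ∧ t = (q.proj c, a, State.proj c '' Q)} ∪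
    {t | ∃ p a Q, (I₁ p, a, Q) ∈ B.trans ∧ t = (.form p (.var Z) c, a, State.proj c '' Q)}
  final := A.final

/-- A fixed-point loop: `Round X Y` says that the recursive call on `X` may return `Y`, and `update`
ends a round. The loop returns as soon as two successive automata agree up to `⪯` (in particular
when they are equal). -/
def Loop (Round : Aut P Γ AP Var E → Aut P Γ AP Var E → Prop)
    (update : Aut P Γ AP Var E → Aut P Γ AP Var E) (A₀ A' : Aut P Γ AP Var E) : Prop :=
  ∃ (n : ℕ) (A B : ℕ → Aut P Γ AP Var E), A 0 = A₀ ∧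
    (∀ i ≤ n, Round (A i) (B i) ∧ A (i + 1) = update (B i)) ∧
    (A n).Le (A (n + 1)) ∧ (A (n + 1)).Le (A n) ∧ A' = A (n + 1)

/-- `Returns M φ lev c A A'`: the algorithm, called with the input automaton `A`, the formula `φ`
and the level `c`, where `lev` gives the levels of the variables in scope, may return the
automaton `A'` (with the initial states `init lev c φ`). -/
def Returns [DecidableEq Var] (M : PDS P Γ) :
    Formula AP Var → (Var → ℕ) → ℕ → Aut P Γ AP Var E → Aut P Γ AP Var E → Prop
  | .atom _, _, _, A, A' => A' = A
  | .natom _, _, _, A, A' => A' = A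
  | .var _, _, _, A, A' => A' = A
  | .and φ ψ, lev, c, A, A' => ∃ A₁ A₂, Returns M φ lev c A A₁ ∧ Returns M ψ lev c A A₂ ∧
      A' = andAut c φ ψ A₁ A₂ (init lev c φ) (init lev c ψ)
  | .or φ ψ, lev, c, A, A' => ∃ A₁ A₂, Returns M φ lev c A A₁ ∧ Returns M ψ lev c A A₂ ∧
      A' = orAut c φ ψ A₁ A₂ (init lev c φ) (init lev c ψ)
  | .box φ, lev, c, A, A' => ∃ A₁, Returns M φ lev c A A₁ ∧ A' = boxAut M c φ A₁ (init lev c φ)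
  | .dia φ, lev, c, A, A' => ∃ A₁, Returns M φ lev c A A₁ ∧ A' = diaAut M c φ A₁ (init lev c φ)
  | .bbox φ, lev, c, A, A' => ∃ A₁, Returns M φ lev c A A₁ ∧ A' = bboxAut M c φ A₁ (init lev c φ)
  | .bdia φ, lev, c, A, A' => ∃ A₁, Returns M φ lev c A A₁ ∧ A' = bdiaAut M c φ A₁ (init lev c φ)
  | .mu Z φ, lev, c, A, A' =>
      Loop (Returns M φ (Function.update lev Z c) (c + 1))
        (fun B => nextRound c Z A B (init (Function.update lev Z c) (c + 1) φ)) (muStart c Z A) A'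
  | .nu Z φ, lev, c, A, A' =>
      Loop (Returns M φ (Function.update lev Z c) (c + 1))
        (fun B => nextRound c Z A B (init (Function.update lev Z c) (c + 1) φ)) (nuStart M c Z A) A'

end Algorithm

/-! ## Valuation soundness -/

section Soundness

variable {P Γ AP Var E : Type*}

/-- `T` assigns sets of words to automaton states in accordance with the environment `ρ` and the
valuation `V` of the variables in `X`, where a variable `Z` lives at level `lev Z`. -/
structure Represents (M : PDS P Γ) (ρ : AP → Set (P × List Γ)) (V : Var → Set (P × List Γ))
    (X : Set Var) (lev : Var → ℕ) (T : State P Γ AP Var E → Set (List Γ)) : Prop where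
  top : T .top = M.stackWords
  fin : T .fin = {[]}
  sub : ∀ q, q ≠ .fin → T q ⊆ M.stackWords
  atom : ∀ p x, T (.form p (.atom x) 0) = {w | (p, w) ∈ ρ x}
  natom : ∀ p x, T (.form p (.natom x) 0) = {w | (p, w) ∈ M.configs \ ρ x}
  var : ∀ p, ∀ Z ∈ X, T (.form p (.var Z) (lev Z)) = {w | (p, w) ∈ V Z}

/-- Valuation soundness of an automaton. -/
def Sound (T : State P Γ AP Var E → Set (List Γ)) (A : Aut P Γ AP Var E) : Prop :=
  ∀ q a Q, (q, a, Q) ∈ A.trans → ∀ w, (∀ q' ∈ Q, w ∈ T q') → a :: w ∈ T q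

open Classical in
/-- Assigns to the states `(p, φ, c)` the set `D` of configurations. -/
noncomputable def setForm (φ : Formula AP Var) (c : ℕ) (D : Set (P × List Γ))
    (T : State P Γ AP Var E → Set (List Γ)) : State P Γ AP Var E → Set (List Γ)
  | .form p ψ d => if ψ = φ ∧ d = c then {w | (p, w) ∈ D} else T (.form p ψ d)
  | q => T q

open Classical in
/-- Assigns to the states `(p, φ, c, a)` the sets `D p a` of words. -/
noncomputable def setInt (φ : Formula AP Var) (c : ℕ) (D : P → Γ → Set (List Γ))
    (T : State P Γ AP Var E → Set (List Γ)) : State P Γ AP Var E → Set (List Γ)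
  | .int p ψ d a => if ψ = φ ∧ d = c then D p a else T (.int p ψ d a)
  | q => T q

/-- The words `w` such that all push transitions to `(p, a w)` start in `D`. -/
def allPush (M : PDS P Γ) (D : Set (P × List Γ)) (p : P) (a : Γ) : Set (List Γ) :=
  {w ∈ M.stackWords | ∀ b v, w = b :: v → ∀ x ∈ M.prePush p a b, (x.1, x.2 :: v) ∈ D}

/-- The words `w` such that some push transition to `(p, a w)` starts in `D`. -/
def somePush (M : PDS P Γ) (D : Set (P × List Γ)) (p : P) (a : Γ) : Set (List Γ) :=
  {w ∈ M.stackWords | ∃ b v, w = b :: v ∧ ∃ x ∈ M.prePush p a b, (x.1, x.2 :: v) ∈ D}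

/-- The updated valuation of the automaton states (written `V^c_φ`): the states of level `c` that
belong to the subformulas of `φ` get the denotations of these subformulas, where the variables
bound in `φ` stand for their fixed points. -/
noncomputable def updVal [DecidableEq Var] (M : PDS P Γ) (ρ : AP → Set (P × List Γ)) (c : ℕ) :
    Formula AP Var → (Var → Set (P × List Γ)) → (State P Γ AP Var E → Set (List Γ)) →
      State P Γ AP Var E → Set (List Γ)
  | .atom _, _, T => T
  | .natom _, _, T => T
  | .var _, _, T => T
  | .and φ ψ, V, T => setForm (.and φ ψ) c (den M ρ V (.and φ ψ))
      (updVal M ρ c ψ V (updVal M ρ c φ V T))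
  | .or φ ψ, V, T => setForm (.or φ ψ) c (den M ρ V (.or φ ψ))
      (updVal M ρ c ψ V (updVal M ρ c φ V T))
  | .box φ, V, T => setForm (.box φ) c (den M ρ V (.box φ)) (updVal M ρ c φ V T)
  | .dia φ, V, T => setForm (.dia φ) c (den M ρ V (.dia φ)) (updVal M ρ c φ V T)
  | .bbox φ, V, T => setInt (.bbox φ) c (allPush M (den M ρ V φ))
      (setForm (.bbox φ) c (den M ρ V (.bbox φ)) (updVal M ρ c φ V T))
  | .bdia φ, V, T => setInt (.bdia φ) c (somePush M (den M ρ V φ))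
      (setForm (.bdia φ) c (den M ρ V (.bdia φ)) (updVal M ρ c φ V T))
  | .mu Z φ, V, T => setForm (.var Z) c (den M ρ V (.mu Z φ))
      (updVal M ρ c φ (Function.update V Z (den M ρ V (.mu Z φ))) T)
  | .nu Z φ, V, T => setForm (.var Z) c (den M ρ V (.nu Z φ))
      (updVal M ρ c φ (Function.update V Z (den M ρ V (.nu Z φ))) T)

end Soundness

end BackMu

open BackMu

/-!
The proof compares `updVal` with a valuation of the automaton states that is easier to handle. Extend
the valuation `V` of the variables to the variables bound in `φ`, which get the denotations of their
fixed points (`fixExt`). By the naming convention, the extension `U` is consistent with all parts of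
`φ` (`FixCompat`), so that every state `(p, ψ, d)` can be given the denotation of `ψ` under this
single `U`, whatever the level (`canonVal`). On the states that the algorithm creates, this is
`updVal` (`updVal_of_mem`); in particular, renaming level `c + 1` to `c` does not affect it.
By induction on `φ`, the algorithm preserves soundness for any valuation that is `canonVal` from
level `c` on (`preservesSound`).

For the connectives, a run over `u` in a sound automaton prepends `u` to a word, so soundness of the
new transitions is the meaning of the modality, together with the classification of predecessors
(`PDS.step_cons_iff`).

For fixed points, `nextRound_step` says what a round does to a sound valuation in which `Z` stands for
an arbitrary set `S`: the states of the body get their denotations under `Z = S`, and the states of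
`Z` get the denotation of the body. For `μ` one takes `S` to be the fixed point throughout. For `ν`,
the loop starts above the fixed point, and each automaton is only sound for an approximation from
above (`nu_loop_approx`). When the loop stops with `A_n ⪯ A_{n+1} ⪯ A_n`, the two automata are sound
for the same valuations (`Sound.of_le`). As soundness is closed under intersections, there is a least
valuation above the intended one for which `A_n` is sound. A round applied to it gives a smaller one,
hence the same one; so its value of `Z` is a post-fixed point of the body, and therefore contained in
the greatest fixed point (`preservesSound_nu`). This argument needs no assumption of finiteness.
-/

namespace BackMu

/-! ### Monotonicity and dependence on free variables of the denotation -/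

section Denotation

variable {P Γ AP Var : Type*} [DecidableEq Var] {M : PDS P Γ} {ρ : AP → Set (P × List Γ)}

lemma den_mono (φ : Formula AP Var) {V V' : Var → Set (P × List Γ)} (h : V ≤ V') :
    den M ρ V φ ⊆ den M ρ V' φ := by
  induction φ generalizing V V' with
  | atom x => exact subset_rfl
  | natom x => exact subset_rfl
  | var Z => exact h Z
  | and φ ψ h₁ h₂ => exact Set.inter_subset_inter (h₁ h) (h₂ h)
  | or φ ψ h₁ h₂ => exact Set.union_subset_union (h₁ h) (h₂ h)
  | box φ ih => exact fun k hk => ⟨hk.1, fun k' hk' hs => ih h (hk.2 k' hk' hs)⟩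
  | dia φ ih => exact fun k ⟨hk, k', hk', hs, hd⟩ => ⟨hk, k', hk', hs, ih h hd⟩
  | bbox φ ih => exact fun k hk => ⟨hk.1, fun k' hk' hs => ih h (hk.2 k' hk' hs)⟩
  | bdia φ ih => exact fun k ⟨hk, k', hk', hs, hd⟩ => ⟨hk, k', hk', hs, ih h hd⟩
  | mu Z φ ih =>
    exact Set.sInter_subset_sInter fun S hS =>
      ⟨hS.1, (ih (update_le_update_iff.2 ⟨le_rfl, fun z _ => h z⟩)).trans hS.2⟩
  | nu Z φ ih =>
    exact Set.sUnion_subset_sUnion fun S hS =>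
      ⟨hS.1, hS.2.trans (ih (update_le_update_iff.2 ⟨le_rfl, fun z _ => h z⟩))⟩

lemma den_congr (φ : Formula AP Var) {V V' : Var → Set (P × List Γ)} (h : Set.EqOn V V' φ.free) :
    den M ρ V φ = den M ρ V' φ := by
  induction φ generalizing V V' with
  | atom x => rfl
  | natom x => rfl
  | var Z => exact h rfl
  | and φ ψ h₁ h₂ =>
    simp only [den, h₁ (h.mono Set.subset_union_left), h₂ (h.mono Set.subset_union_right)]
  | or φ ψ h₁ h₂ =>
    simp only [den, h₁ (h.mono Set.subset_union_left), h₂ (h.mono Set.subset_union_right)]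
  | box φ ih => simp only [den, ih h]
  | dia φ ih => simp only [den, ih h]
  | bbox φ ih => simp only [den, ih h]
  | bdia φ ih => simp only [den, ih h]
  | mu Z φ ih | nu Z φ ih =>
    have key : ∀ S, den M ρ (Function.update V Z S) φ = den M ρ (Function.update V' Z S) φ := by
      refine fun S => ih fun z hz => ?_
      by_cases hzZ : z = Z
      · subst hzZ; simp
      · simpa [hzZ] using h ⟨hz, hzZ⟩
    simp only [den, key]

lemma update_le_configs {V : Var → Set (P × List Γ)} (hV : ∀ Z, V Z ⊆ M.configs) (Z : Var)
    {S : Set (P × List Γ)} (hS : S ⊆ M.configs) : ∀ z, Function.update V Z S z ⊆ M.configs := by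
  intro z
  by_cases hz : z = Z
  · subst hz; simpa using hS
  · simpa [hz] using hV z

lemma den_subset_configs (hρ : ∀ x, ρ x ⊆ M.configs) (φ : Formula AP Var)
    {V : Var → Set (P × List Γ)} (hV : ∀ Z, V Z ⊆ M.configs) : den M ρ V φ ⊆ M.configs := by
  induction φ generalizing V with
  | atom x => exact hρ x
  | natom x => exact Set.sdiff_subset
  | var Z => exact hV Z
  | and φ ψ h₁ h₂ => exact Set.inter_subset_left.trans (h₁ hV)
  | or φ ψ h₁ h₂ => exact Set.union_subset (h₁ hV) (h₂ hV)
  | box φ ih => exact fun k hk => hk.1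
  | dia φ ih => exact fun k hk => hk.1
  | bbox φ ih => exact fun k hk => hk.1
  | bdia φ ih => exact fun k hk => hk.1
  | mu Z φ ih =>
    exact Set.sInter_subset_of_mem ⟨subset_rfl, ih (update_le_configs hV Z subset_rfl)⟩
  | nu Z φ ih => exact Set.sUnion_subset fun S hS => hS.1

lemma den_mu_unfold (hρ : ∀ x, ρ x ⊆ M.configs) (Z : Var) (φ : Formula AP Var)
    {V : Var → Set (P × List Γ)} (hV : ∀ Z, V Z ⊆ M.configs) :
    den M ρ (Function.update V Z (den M ρ V (.mu Z φ))) φ = den M ρ V (.mu Z φ) := by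
  have hle : den M ρ (Function.update V Z (den M ρ V (.mu Z φ))) φ ⊆ den M ρ V (.mu Z φ) :=
    Set.subset_sInter fun S hS =>
      (den_mono φ (update_le_update_iff.2
        ⟨Set.sInter_subset_of_mem hS, fun _ _ => le_rfl⟩)).trans hS.2
  have hc := den_subset_configs hρ (.mu Z φ) hV
  refine hle.antisymm (Set.sInter_subset_of_mem ⟨hle.trans hc, den_mono φ ?_⟩)
  exact update_le_update_iff.2 ⟨hle, fun _ _ => le_rfl⟩

lemma den_nu_unfold (hρ : ∀ x, ρ x ⊆ M.configs) (Z : Var) (φ : Formula AP Var)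
    {V : Var → Set (P × List Γ)} (hV : ∀ Z, V Z ⊆ M.configs) :
    den M ρ (Function.update V Z (den M ρ V (.nu Z φ))) φ = den M ρ V (.nu Z φ) := by
  have hle : den M ρ V (.nu Z φ) ⊆ den M ρ (Function.update V Z (den M ρ V (.nu Z φ))) φ :=
    Set.sUnion_subset fun S hS => hS.2.trans
      (den_mono φ (update_le_update_iff.2
        ⟨Set.subset_sUnion_of_mem (S := {S | S ⊆ M.configs ∧ S ⊆ den M ρ (Function.update V Z S) φ})
          hS, fun _ _ => le_rfl⟩))
  refine Set.Subset.antisymm ?_ hle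
  refine Set.subset_sUnion_of_mem (S := {S | S ⊆ M.configs ∧ S ⊆ den M ρ (Function.update V Z S) φ})
    ⟨den_subset_configs hρ φ (update_le_configs hV Z (den_subset_configs hρ (.nu Z φ) hV)), ?_⟩
  exact den_mono φ (update_le_update_iff.2 ⟨hle, fun _ _ => le_rfl⟩)

end Denotation

/-! ### Valuations that interpret bound variables by their fixed points -/

section FixVal

variable {P Γ AP Var : Type*}

lemma Formula.WellNamed.disjoint_free_bound {φ : Formula AP Var} (h : φ.WellNamed) :
    Disjoint φ.free φ.bound := by
  induction φ with
  | atom x => exact disjoint_bot_left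
  | natom x => exact disjoint_bot_left
  | var Z => exact disjoint_bot_right
  | and φ ψ h₁ h₂ | or φ ψ h₁ h₂ =>
    obtain ⟨hφ, hψ, -, hbf, hfb⟩ := h
    simp only [Formula.free, Formula.bound, Set.disjoint_union_left, Set.disjoint_union_right]
    exact ⟨⟨h₁ hφ, hbf.symm⟩, hfb, h₂ hψ⟩
  | box φ ih | dia φ ih | bbox φ ih | bdia φ ih => exact ih h
  | mu Z φ ih | nu Z φ ih =>
    refine Set.disjoint_left.2 fun z hz hz' => ?_
    rcases hz' with rfl | hz'
    · exact hz.2 rfl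
    · exact Set.disjoint_left.1 (ih h.1) hz.1 hz'

variable [DecidableEq Var] (M : PDS P Γ) (ρ : AP → Set (P × List Γ))

/-- `FixCompat M ρ U φ`: the valuation `U` assigns to each variable bound in `φ` the denotation,
under `U` itself, of the fixed-point subformula that binds it. -/
def FixCompat (U : Var → Set (P × List Γ)) : Formula AP Var → Prop
  | .atom _ => True
  | .natom _ => True
  | .var _ => True
  | .and φ ψ => FixCompat U φ ∧ FixCompat U ψ
  | .or φ ψ => FixCompat U φ ∧ FixCompat U ψ
  | .box φ => FixCompat U φ
  | .dia φ => FixCompat U φ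
  | .bbox φ => FixCompat U φ
  | .bdia φ => FixCompat U φ
  | .mu Z φ => U Z = den M ρ U (.mu Z φ) ∧ FixCompat U φ
  | .nu Z φ => U Z = den M ρ U (.nu Z φ) ∧ FixCompat U φ

/-- The valuation `V`, changed at the variables bound in `φ`, which get the denotations of their
fixed points. -/
def fixExt : Formula AP Var → (Var → Set (P × List Γ)) → Var → Set (P × List Γ)
  | .atom _, V => V
  | .natom _, V => V
  | .var _, V => V
  | .and φ ψ, V => fixExt ψ (fixExt φ V)
  | .or φ ψ, V => fixExt ψ (fixExt φ V)
  | .box φ, V => fixExt φ V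
  | .dia φ, V => fixExt φ V
  | .bbox φ, V => fixExt φ V
  | .bdia φ, V => fixExt φ V
  | .mu Z φ, V => fixExt φ (Function.update V Z (den M ρ V (.mu Z φ)))
  | .nu Z φ, V => fixExt φ (Function.update V Z (den M ρ V (.nu Z φ)))

variable {M ρ}

lemma fixExt_of_notMem (φ : Formula AP Var) (V : Var → Set (P × List Γ)) {z : Var}
    (hz : z ∉ φ.bound) : fixExt M ρ φ V z = V z := by
  induction φ generalizing V with
  | atom x | natom x | var Z => rfl
  | and φ ψ h₁ h₂ | or φ ψ h₁ h₂ =>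
    simp only [Formula.bound, Set.mem_union, not_or] at hz
    simp only [fixExt, h₁ _ hz.1, h₂ _ hz.2]
  | box φ ih | dia φ ih | bbox φ ih | bdia φ ih => exact ih V hz
  | mu Z φ ih | nu Z φ ih =>
    simp only [Formula.bound, Set.mem_insert_iff, not_or] at hz
    simp only [fixExt, ih _ hz.2, Function.update_of_ne hz.1]

lemma fixExt_mono (φ : Formula AP Var) {V V' : Var → Set (P × List Γ)} (h : V ≤ V') :
    fixExt M ρ φ V ≤ fixExt M ρ φ V' := by
  induction φ generalizing V V' with
  | atom x | natom x | var Z => exact h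
  | and φ ψ h₁ h₂ | or φ ψ h₁ h₂ => exact h₂ (h₁ h)
  | box φ ih | dia φ ih | bbox φ ih | bdia φ ih => exact ih h
  | mu Z φ ih | nu Z φ ih =>
    exact ih (update_le_update_iff.2 ⟨den_mono _ h, fun z _ => h z⟩)

lemma fixExt_subset_configs (hρ : ∀ x, ρ x ⊆ M.configs) (φ : Formula AP Var)
    {V : Var → Set (P × List Γ)} (hV : ∀ Z, V Z ⊆ M.configs) :
    ∀ Z, fixExt M ρ φ V Z ⊆ M.configs := by
  induction φ generalizing V with
  | atom x | natom x | var Z => exact hV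
  | and φ ψ h₁ h₂ | or φ ψ h₁ h₂ => exact h₂ (h₁ hV)
  | box φ ih | dia φ ih | bbox φ ih | bdia φ ih => exact ih hV
  | mu Z φ ih | nu Z φ ih => exact ih (update_le_configs hV Z (den_subset_configs hρ _ hV))

lemma fixExt_eq_self {φ : Formula AP Var} {U : Var → Set (P × List Γ)} (h : FixCompat M ρ U φ) :
    fixExt M ρ φ U = U := by
  induction φ with
  | atom x | natom x | var Z => rfl
  | and φ ψ h₁ h₂ | or φ ψ h₁ h₂ => simp only [fixExt, h₁ h.1, h₂ h.2]
  | box φ ih | dia φ ih | bbox φ ih | bdia φ ih => exact ih h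
  | mu Z φ ih | nu Z φ ih => simp only [fixExt, ← h.1, Function.update_eq_self, ih h.2]

lemma FixCompat.congr {φ : Formula AP Var} {U U' : Var → Set (P × List Γ)}
    (h : FixCompat M ρ U φ) (hU : Set.EqOn U U' (φ.free ∪ φ.bound)) : FixCompat M ρ U' φ := by
  induction φ with
  | atom x | natom x | var Z => trivial
  | and φ ψ h₁ h₂ | or φ ψ h₁ h₂ =>
    exact ⟨h₁ h.1 (hU.mono (Set.union_subset_union Set.subset_union_left Set.subset_union_left)),
      h₂ h.2 (hU.mono (Set.union_subset_union Set.subset_union_right Set.subset_union_right))⟩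
  | box φ ih | dia φ ih | bbox φ ih | bdia φ ih => exact ih h hU
  | mu Z φ ih | nu Z φ ih =>
    refine ⟨?_, ih h.2 (hU.mono ?_)⟩
    · rw [← den_congr _ (hU.mono Set.subset_union_left), ← h.1]
      exact (hU (Or.inr (Set.mem_insert _ _))).symm
    · rintro z (hz | hz)
      · by_cases hzZ : z = Z
        · exact Or.inr (hzZ ▸ Set.mem_insert _ _)
        · exact Or.inl ⟨hz, hzZ⟩
      · exact Or.inr (Set.mem_insert_of_mem _ hz)

/-- Under the naming convention, interpreting the variables bound in one part of the formula does
not disturb the other parts. -/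
lemma fixCompat_fixExt {φ : Formula AP Var} (hφ : φ.WellNamed) (V : Var → Set (P × List Γ)) :
    FixCompat M ρ (fixExt M ρ φ V) φ := by
  induction φ generalizing V with
  | atom x | natom x | var Z => trivial
  | and φ ψ h₁ h₂ | or φ ψ h₁ h₂ =>
    obtain ⟨hφ, hψ, hbb, hbf, hfb⟩ := hφ
    refine ⟨(h₁ hφ V).congr ?_, h₂ hψ _⟩
    rintro z (hz | hz)
    · exact (fixExt_of_notMem ψ _ (Set.disjoint_left.1 hfb hz)).symm
    · exact (fixExt_of_notMem ψ _ (Set.disjoint_left.1 hbb hz)).symm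
  | box φ ih | dia φ ih | bbox φ ih | bdia φ ih => exact ih hφ V
  | mu Z φ ih | nu Z φ ih =>
    refine ⟨?_, ih hφ.1 _⟩
    simp only [fixExt]
    rw [fixExt_of_notMem φ _ hφ.2, Function.update_self]
    refine den_congr _ fun z hz => ?_
    rw [fixExt_of_notMem φ _ (Set.disjoint_left.1 hφ.1.disjoint_free_bound hz.1),
      Function.update_of_ne hz.2]

/-- The value of a fixed-point formula is a fixed point, in the form needed for a valuation that
already assigns this value to the bound variable. -/
lemma FixCompat.den_mu_body (hρ : ∀ x, ρ x ⊆ M.configs) {Z : Var} {φ : Formula AP Var}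
    {U : Var → Set (P × List Γ)} (hU : ∀ Z, U Z ⊆ M.configs) (h : FixCompat M ρ U (.mu Z φ)) :
    den M ρ U φ = U Z := by
  have := den_mu_unfold hρ Z φ hU
  rwa [← h.1, Function.update_eq_self] at this

lemma FixCompat.den_nu_body (hρ : ∀ x, ρ x ⊆ M.configs) {Z : Var} {φ : Formula AP Var}
    {U : Var → Set (P × List Γ)} (hU : ∀ Z, U Z ⊆ M.configs) (h : FixCompat M ρ U (.nu Z φ)) :
    den M ρ U φ = U Z := by
  have := den_nu_unfold hρ Z φ hU
  rwa [← h.1, Function.update_eq_self] at this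

end FixVal

/-! ### The states of a formula and their canonical values -/

section Canonical

variable {P Γ AP Var E : Type*}

/-- The states that the algorithm creates for `φ` at level `c`, together with the unused states
`(p, ψ, c, a)` where `a` is the bottom symbol. -/
def ownStates : Formula AP Var → ℕ → Set (State P Γ AP Var E)
  | .atom _, _ => ∅
  | .natom _, _ => ∅
  | .var _, _ => ∅
  | .and φ ψ, c => formStates (.and φ ψ) c ∪ (ownStates φ c ∪ ownStates ψ c)
  | .or φ ψ, c => formStates (.or φ ψ) c ∪ (ownStates φ c ∪ ownStates ψ c)
  | .box φ, c => formStates (.box φ) c ∪ ownStates φ c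
  | .dia φ, c => formStates (.dia φ) c ∪ ownStates φ c
  | .bbox φ, c => formStates (.bbox φ) c ∪ {q | ∃ p a, q = .int p (.bbox φ) c a} ∪ ownStates φ c
  | .bdia φ, c => formStates (.bdia φ) c ∪ {q | ∃ p a, q = .int p (.bdia φ) c a} ∪ ownStates φ c
  | .mu Z φ, c => formStates (.var Z) c ∪ ownStates φ c
  | .nu Z φ, c => formStates (.var Z) c ∪ ownStates φ c

lemma level_of_mem_formStates {φ : Formula AP Var} {c : ℕ} {q : State P Γ AP Var E}
    (h : q ∈ (formStates φ c : Set (State P Γ AP Var E))) : q.level = c := by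
  obtain ⟨p, rfl⟩ := h
  rfl

lemma level_of_mem_ownStates {φ : Formula AP Var} {c : ℕ} {q : State P Γ AP Var E}
    (h : q ∈ ownStates φ c) : q.level = c := by
  induction φ with
  | atom x | natom x | var Z => exact h.elim
  | and φ ψ h₁ h₂ | or φ ψ h₁ h₂ =>
    rcases h with ⟨p, rfl⟩ | h | h
    exacts [rfl, h₁ h, h₂ h]
  | box φ ih | dia φ ih | mu Z φ ih | nu Z φ ih =>
    rcases h with ⟨p, rfl⟩ | h
    exacts [rfl, ih h]
  | bbox φ ih | bdia φ ih =>
    rcases h with (⟨p, rfl⟩ | ⟨p, a, rfl⟩) | h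
    exacts [rfl, rfl, ih h]

lemma proj_mem_ownStates {φ : Formula AP Var} {c : ℕ} {q : State P Γ AP Var E}
    (h : q ∈ ownStates φ (c + 1)) : q.proj c ∈ ownStates φ c := by
  induction φ with
  | atom x | natom x | var Z => exact h.elim
  | and φ ψ h₁ h₂ | or φ ψ h₁ h₂ =>
    rcases h with ⟨p, rfl⟩ | h | h
    exacts [Or.inl ⟨p, by simp [State.proj]⟩, Or.inr (Or.inl (h₁ h)), Or.inr (Or.inr (h₂ h))]
  | box φ ih | dia φ ih | mu Z φ ih | nu Z φ ih =>
    rcases h with ⟨p, rfl⟩ | h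
    exacts [Or.inl ⟨p, by simp [State.proj]⟩, Or.inr (ih h)]
  | bbox φ ih | bdia φ ih =>
    rcases h with (⟨p, rfl⟩ | ⟨p, a, rfl⟩) | h
    exacts [Or.inl (Or.inl ⟨p, by simp [State.proj]⟩),
      Or.inl (Or.inr ⟨p, a, by simp [State.proj]⟩), Or.inr (ih h)]

lemma mem_bound_of_mem_ownStates {φ : Formula AP Var} {c d : ℕ} {p : P} {Z : Var}
    (h : (.form p (.var Z) d : State P Γ AP Var E) ∈ ownStates φ c) : Z ∈ φ.bound := by
  induction φ with
  | atom x | natom x | var Z => exact h.elim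
  | and φ ψ h₁ h₂ | or φ ψ h₁ h₂ =>
    rcases h with ⟨p, h⟩ | h | h
    exacts [by simp at h, Or.inl (h₁ h), Or.inr (h₂ h)]
  | box φ ih | dia φ ih =>
    rcases h with ⟨p, h⟩ | h
    exacts [by simp at h, ih h]
  | bbox φ ih | bdia φ ih =>
    rcases h with (⟨p, h⟩ | ⟨p, a, h⟩) | h
    exacts [by simp at h, by simp at h, ih h]
  | mu Z φ ih | nu Z φ ih =>
    rcases h with ⟨p, h⟩ | h
    · left; simp at h; exact h.2.1
    · exact Or.inr (ih h)

lemma State.proj_eq_self {c : ℕ} {q : State P Γ AP Var E} (h : q.level ≠ c + 1) :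
    q.proj c = q := by
  cases q <;> simp_all [State.proj, State.level]

lemma State.level_proj {c : ℕ} {q : State P Γ AP Var E} (h : q.level = c + 1) :
    (q.proj c).level = c := by
  cases q <;> simp_all [State.proj, State.level]

lemma setForm_of_ne {φ : Formula AP Var} {c : ℕ} {D : Set (P × List Γ)}
    {T : State P Γ AP Var E → Set (List Γ)} {q : State P Γ AP Var E}
    (h : q ∉ (formStates φ c : Set (State P Γ AP Var E))) : setForm φ c D T q = T q := by
  rcases q with _ | _ | ⟨p, ψ, d⟩ | _ | _
  case form => exact if_neg fun hh => h ⟨p, by rw [hh.1, hh.2]⟩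
  all_goals rfl

lemma setForm_self {φ : Formula AP Var} {c : ℕ} {D : Set (P × List Γ)}
    {T : State P Γ AP Var E → Set (List Γ)} (p : P) :
    setForm φ c D T (.form p φ c) = {w | (p, w) ∈ D} := if_pos ⟨rfl, rfl⟩

lemma setInt_of_ne {φ : Formula AP Var} {c : ℕ} {D : P → Γ → Set (List Γ)}
    {T : State P Γ AP Var E → Set (List Γ)} {q : State P Γ AP Var E}
    (h : ¬ ∃ p a, q = .int p φ c a) : setInt φ c D T q = T q := by
  rcases q with _ | _ | _ | ⟨p, ψ, d, a⟩ | _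
  case int => exact if_neg fun hh => h ⟨p, a, by rw [hh.1, hh.2]⟩
  all_goals rfl

lemma setInt_self {φ : Formula AP Var} {c : ℕ} {D : P → Γ → Set (List Γ)}
    {T : State P Γ AP Var E → Set (List Γ)} (p : P) (a : Γ) :
    setInt φ c D T (.int p φ c a) = D p a := if_pos ⟨rfl, rfl⟩

variable [DecidableEq Var]

/-- The value that a state of the algorithm should have when the variables, free and bound, have
the values `U`. It does not depend on the level. -/
def canonVal (M : PDS P Γ) (ρ : AP → Set (P × List Γ)) (U : Var → Set (P × List Γ)) :
    State P Γ AP Var E → Set (List Γ)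
  | .form p φ _ => {w | (p, w) ∈ den M ρ U φ}
  | .int p (.bbox φ) _ a => allPush M (den M ρ U φ) p a
  | .int p (.bdia φ) _ a => somePush M (den M ρ U φ) p a
  | _ => ∅

variable {M : PDS P Γ} {ρ : AP → Set (P × List Γ)} {U V : Var → Set (P × List Γ)}

lemma canonVal_proj (c : ℕ) (q : State P Γ AP Var E) :
    canonVal M ρ U (q.proj c) = canonVal M ρ U q := by
  rcases q with _ | _ | _ | ⟨_, φ, _, _⟩ | _
  case int => cases φ <;> rfl
  all_goals rfl

lemma canonVal_mono (h : U ≤ V) :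
    (canonVal M ρ U : State P Γ AP Var E → _) ≤ canonVal M ρ V := by
  intro q
  rcases q with _ | _ | ⟨p, φ, d⟩ | ⟨p, φ, d, a⟩ | _
  case form => exact fun w hw => den_mono φ h hw
  case int =>
    cases φ
    case bbox φ => exact fun w hw => ⟨hw.1, fun b v hb x hx => den_mono φ h (hw.2 b v hb x hx)⟩
    case bdia φ =>
      exact fun w ⟨hw, b, v, hb, x, hx, hd⟩ => ⟨hw, b, v, hb, x, hx, den_mono φ h hd⟩
    all_goals exact subset_rfl
  all_goals exact subset_rfl

lemma canonVal_subset_stackWords (hρ : ∀ x, ρ x ⊆ M.configs) (hU : ∀ Z, U Z ⊆ M.configs)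
    (q : State P Γ AP Var E) : canonVal M ρ U q ⊆ M.stackWords := by
  rcases q with _ | _ | ⟨p, φ, d⟩ | ⟨p, φ, d, a⟩ | _
  case form => exact fun w hw => den_subset_configs hρ φ hU hw
  case int =>
    cases φ
    case bbox φ => exact fun w hw => hw.1
    case bdia φ => exact fun w hw => hw.1
    all_goals exact Set.empty_subset _
  all_goals exact Set.empty_subset _

lemma updVal_of_notMem (φ : Formula AP Var) {c : ℕ} {V : Var → Set (P × List Γ)}
    {T : State P Γ AP Var E → Set (List Γ)} {q : State P Γ AP Var E}
    (h : q ∉ (ownStates φ c : Set (State P Γ AP Var E))) : updVal M ρ c φ V T q = T q := by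
  induction φ generalizing V T with
  | atom x | natom x | var Z => rfl
  | and φ ψ h₁ h₂ | or φ ψ h₁ h₂ =>
    simp only [ownStates, Set.mem_union, not_or] at h
    simp only [updVal]
    rw [setForm_of_ne h.1, h₂ h.2.2, h₁ h.2.1]
  | box φ ih | dia φ ih | mu Z φ ih | nu Z φ ih =>
    simp only [ownStates, Set.mem_union, not_or] at h
    simp only [updVal]
    rw [setForm_of_ne h.1, ih h.2]
  | bbox φ ih | bdia φ ih =>
    simp only [ownStates, Set.mem_union, not_or] at h
    simp only [updVal]
    rw [setInt_of_ne h.1.2, setForm_of_ne h.1.1, ih h.2]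

/-- Where subformulas occur in several places, the nested updates of `updVal` assign the same value
each time: the denotation under a valuation that interprets the bound variables. -/
lemma updVal_of_mem {φ : Formula AP Var} {c : ℕ} {V : Var → Set (P × List Γ)}
    {T : State P Γ AP Var E → Set (List Γ)} {q : State P Γ AP Var E}
    (hU : FixCompat M ρ U φ) (hV : Set.EqOn V U φ.free)
    (h : q ∈ (ownStates φ c : Set (State P Γ AP Var E))) :
    updVal M ρ c φ V T q = canonVal M ρ U q := by
  have hd := den_congr (M := M) (ρ := ρ) φ hV
  induction φ generalizing V T with
  | atom x | natom x | var Z => exact h.elim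
  | and φ ψ h₁ h₂ | or φ ψ h₁ h₂ =>
    have hVφ := hV.mono Set.subset_union_left
    have hVψ := hV.mono Set.subset_union_right
    rw [ownStates, ← Set.union_sdiff_self] at h
    simp only [updVal]
    rcases h with ⟨p, rfl⟩ | ⟨h, hf⟩
    · rw [setForm_self, hd]; rfl
    rw [setForm_of_ne hf]
    by_cases hψ : q ∈ ownStates ψ c
    · exact h₂ hU.2 hVψ hψ (den_congr _ hVψ)
    · rw [updVal_of_notMem ψ hψ]
      exact h₁ hU.1 hVφ (h.resolve_right hψ) (den_congr _ hVφ)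
  | box φ ih | dia φ ih =>
    rw [ownStates, ← Set.union_sdiff_self] at h
    simp only [updVal]
    rcases h with ⟨p, rfl⟩ | ⟨h, hf⟩
    · rw [setForm_self, hd]; rfl
    rw [setForm_of_ne hf]
    exact ih hU hV h (den_congr _ hV)
  | bbox φ ih | bdia φ ih =>
    rw [ownStates, ← Set.union_sdiff_self] at h
    simp only [updVal]
    rcases h with (⟨p, rfl⟩ | ⟨p, a, rfl⟩) | ⟨h, hf⟩
    · rw [setInt_of_ne (by simp), setForm_self, hd]; rfl
    · rw [setInt_self, den_congr φ hV]; rfl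
    rw [setInt_of_ne fun hi => hf (Or.inr hi), setForm_of_ne fun hi => hf (Or.inl hi)]
    exact ih hU hV h (den_congr _ hV)
  | mu Z φ ih | nu Z φ ih =>
    rw [ownStates, ← Set.union_sdiff_self] at h
    simp only [updVal]
    rcases h with ⟨p, rfl⟩ | ⟨h, hf⟩
    · rw [setForm_self, hd, ← hU.1]; rfl
    rw [setForm_of_ne hf]
    have hV' : Set.EqOn (Function.update V Z (U Z)) U φ.free := by
      intro z hz
      by_cases hzZ : z = Z
      · subst hzZ; simp
      · rw [Function.update_of_ne hzZ]; exact hV ⟨hz, hzZ⟩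
    rw [hd, ← hU.1]
    exact ih hU.2 hV' h (den_congr _ hV')

end Canonical

/-! ### Runs and the states that occur in transitions -/

section Automata

variable {P Γ AP Var E : Type*}

/-- All states that occur in transitions of `A` belong to `K`. -/
def Aut.Within (A : Aut P Γ AP Var E) (K : Set (State P Γ AP Var E)) : Prop :=
  ∀ q a Q, (q, a, Q) ∈ A.trans → q ∈ K ∧ Q ⊆ K

lemma Aut.Within.mono {A : Aut P Γ AP Var E} {K L : Set (State P Γ AP Var E)} (h : A.Within K)
    (hKL : K ⊆ L) : A.Within L :=
  fun q a Q ht => ⟨hKL (h q a Q ht).1, (h q a Q ht).2.trans hKL⟩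

lemma Aut.Within.runSet_subset {A : Aut P Γ AP Var E} {K : Set (State P Γ AP Var E)}
    (h : A.Within K) {w : List Γ} {Q Q' : Set (State P Γ AP Var E)} (hQ : Q ⊆ K)
    (hr : A.RunSet Q w Q') : Q' ⊆ K := by
  induction w generalizing Q with
  | nil => exact (show Q' = Q from hr) ▸ hQ
  | cons a w ih =>
    obtain ⟨R, ⟨g, hg, rfl⟩, hr⟩ := hr
    exact ih (Set.iUnion₂_subset fun q hq => (h _ _ _ (hg q hq)).2) hr

lemma Aut.Within.run_subset {A : Aut P Γ AP Var E} {K : Set (State P Γ AP Var E)}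
    (h : A.Within K) {w : List Γ} {q : State P Γ AP Var E} {Q : Set (State P Γ AP Var E)}
    (hq : q ∈ K) (hr : A.Run q w Q) : Q ⊆ K :=
  h.runSet_subset (Set.singleton_subset_iff.2 hq) hr

lemma Sound.runSet {T : State P Γ AP Var E → Set (List Γ)} {A : Aut P Γ AP Var E}
    (h : Sound T A) {u w : List Γ} {Q Q' : Set (State P Γ AP Var E)} (hr : A.RunSet Q u Q')
    (hw : ∀ q ∈ Q', w ∈ T q) : ∀ q ∈ Q, u ++ w ∈ T q := by
  induction u generalizing Q with
  | nil => exact (show Q' = Q from hr) ▸ hw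
  | cons a u ih =>
    obtain ⟨R, ⟨g, hg, rfl⟩, hr⟩ := hr
    exact fun q hq => h q a (g q) (hg q hq) _ fun q' hq' => ih hr q' (Set.mem_biUnion hq hq')

lemma Sound.run {T : State P Γ AP Var E → Set (List Γ)} {A : Aut P Γ AP Var E}
    (h : Sound T A) {u w : List Γ} {q : State P Γ AP Var E} {Q : Set (State P Γ AP Var E)}
    (hr : A.Run q u Q) (hw : ∀ q ∈ Q, w ∈ T q) : u ++ w ∈ T q :=
  h.runSet hr hw q rfl

/-- Soundness depends only on the transitions up to `⪯`: the state `q*` in a target imposes nothing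
when the target contains some other state that has only stacks as values. -/
lemma Sound.of_le {M : PDS P Γ} {T : State P Γ AP Var E → Set (List Γ)} {A B : Aut P Γ AP Var E}
    (hB : Sound T B) (hle : A.Le B) (htop : T .top = M.stackWords)
    (hsub : ∀ q, q ≠ .fin → T q ⊆ M.stackWords) : Sound T A := by
  intro q a Q ht w hw
  obtain ⟨Q', ht', hbelow⟩ := hle q a Q ht
  refine hB q a Q' ht' w fun q' hq' => ?_
  rcases hbelow q' hq' with h | ⟨rfl, r, hr, hrf⟩
  · exact hw q' h
  · exact htop ▸ hsub r hrf (hw r hr)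

lemma Sound.congr {T T' : State P Γ AP Var E → Set (List Γ)} {A : Aut P Γ AP Var E}
    {K : Set (State P Γ AP Var E)} (h : Sound T A) (hA : A.Within K) (hT : Set.EqOn T T' K) :
    Sound T' A := by
  intro q a Q ht w hw
  obtain ⟨hq, hQ⟩ := hA q a Q ht
  rw [← hT hq]
  exact h q a Q ht w fun q' hq' => (hT (hQ hq')).symm ▸ hw q' hq'

/-- Valuations for which an automaton is sound are closed under intersection. -/
lemma sound_sInter (F : Set (State P Γ AP Var E → Set (List Γ))) {A : Aut P Γ AP Var E}
    (h : ∀ X ∈ F, Sound X A) : Sound (fun q => {w | ∀ X ∈ F, w ∈ X q}) A :=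
  fun q a Q ht w hw X hX => h X hX q a Q ht w fun q' hq' => hw q' hq' X hX

lemma init_mem (lev : Var → ℕ) (c : ℕ) (φ : Formula AP Var) (p : P)
    {K : Set (State P Γ AP Var E)} (h0 : ∀ q : State P Γ AP Var E, q.level = 0 → q ∈ K)
    (hv : ∀ Z ∈ φ.free, ∀ p, .form p (.var Z) (lev Z) ∈ K) :
    init lev c φ p ∈ K ∪ ownStates φ c := by
  cases φ with
  | atom x | natom x => exact Or.inl (h0 _ rfl)
  | var Z => exact Or.inl (hv Z rfl p)
  | and φ ψ | or φ ψ | box φ | dia φ | mu Z φ | nu Z φ => exact Or.inr (Or.inl ⟨p, rfl⟩)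
  | bbox φ | bdia φ => exact Or.inr (Or.inl (Or.inl ⟨p, rfl⟩))

lemma nextRound_within {φ : Formula AP Var} {c : ℕ} {Z : Var} {A B : Aut P Γ AP Var E}
    {I : P → State P Γ AP Var E} {K : Set (State P Γ AP Var E)} (hK : ∀ q ∈ K, q.level < c)
    (hA : A.Within K)
    (hB : B.Within (K ∪ (formStates (.var Z) c ∪ ownStates φ c) ∪ ownStates φ (c + 1))) :
    (nextRound c Z A B I).Within (K ∪ (formStates (.var Z) c ∪ ownStates φ c)) := by
  have hproj : ∀ q ∈ K ∪ (formStates (.var Z) c ∪ ownStates φ c) ∪ ownStates φ (c + 1),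
      q.proj c ∈ K ∪ (formStates (.var Z) c ∪ ownStates φ c) := by
    rintro q (hq | hq)
    · rwa [State.proj_eq_self]
      rcases hq with hq | ⟨p, rfl⟩ | hq
      · have := hK q hq; lia
      · simp [State.level]
      · rw [level_of_mem_ownStates hq]; lia
    · exact Or.inr (Or.inr (proj_mem_ownStates hq))
  rintro q a Q ((ht | ⟨q, a, Q, ht, -, he⟩) | ⟨p, a, Q, ht, he⟩)
  · exact hA.mono Set.subset_union_left q a Q ht
  · cases he
    exact ⟨hproj q (hB _ _ _ ht).1, Set.image_subset_iff.2 fun r hr => hproj r ((hB _ _ _ ht).2 hr)⟩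
  · cases he
    exact ⟨Or.inr (Or.inl ⟨p, rfl⟩),
      Set.image_subset_iff.2 fun r hr => hproj r ((hB _ _ _ ht).2 hr)⟩

lemma muStart_within {φ : Formula AP Var} {c : ℕ} {Z : Var} {A : Aut P Γ AP Var E}
    {K : Set (State P Γ AP Var E)} (hA : A.Within K) :
    (muStart c Z A).Within (K ∪ (formStates (.var Z) c ∪ ownStates φ c)) :=
  hA.mono Set.subset_union_left

lemma nuStart_within {M : PDS P Γ} {φ : Formula AP Var} {c : ℕ} {Z : Var} {A : Aut P Γ AP Var E}
    {K : Set (State P Γ AP Var E)} (h0 : ∀ q : State P Γ AP Var E, q.level = 0 → q ∈ K)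
    (hA : A.Within K) :
    (nuStart M c Z A).Within (K ∪ (formStates (.var Z) c ∪ ownStates φ c)) := by
  rintro q a Q ((ht | ⟨p, a, -, he⟩) | ⟨p, he⟩)
  · exact hA.mono Set.subset_union_left q a Q ht
  · cases he
    exact ⟨Or.inr (Or.inl ⟨p, rfl⟩), Set.singleton_subset_iff.2 (Or.inl (h0 _ rfl))⟩
  · cases he
    exact ⟨Or.inr (Or.inl ⟨p, rfl⟩), Set.singleton_subset_iff.2 (Or.inl (h0 _ rfl))⟩

variable [DecidableEq Var] {M : PDS P Γ}

/-- The input automata of the rounds of a fixed-point loop only use the states in `K` and those of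
the fixed-point formula at level `c`, if this is so for the first of them and if the recursive calls
only add states of level `c + 1`. -/
lemma loop_within {φ : Formula AP Var} {c : ℕ} {Z : Var} {lev : Var → ℕ}
    {A : Aut P Γ AP Var E} {K : Set (State P Γ AP Var E)} (hK : ∀ q ∈ K, q.level < c)
    (hA : A.Within K)
    (hcall : ∀ X Y, X.Within (K ∪ (formStates (.var Z) c ∪ ownStates φ c)) →
      Returns M φ (Function.update lev Z c) (c + 1) X Y →
      Y.Within (K ∪ (formStates (.var Z) c ∪ ownStates φ c) ∪ ownStates φ (c + 1)))
    {As Bs : ℕ → Aut P Γ AP Var E} {n : ℕ}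
    (h0 : (As 0).Within (K ∪ (formStates (.var Z) c ∪ ownStates φ c)))
    (hs : ∀ i ≤ n, Returns M φ (Function.update lev Z c) (c + 1) (As i) (Bs i) ∧
      As (i + 1) = nextRound c Z A (Bs i) (init (Function.update lev Z c) (c + 1) φ)) :
    ∀ i ≤ n + 1, (As i).Within (K ∪ (formStates (.var Z) c ∪ ownStates φ c)) := by
  intro i hi
  induction i with
  | zero => exact h0
  | succ i ih =>
    rw [(hs i (by lia)).2]
    exact nextRound_within hK hA (hcall _ _ (ih (by lia)) (hs i (by lia)).1)

/-- The automaton returned for `φ` at level `c` uses no other states than its input, apart from the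
states of `φ` at level `c`. -/
lemma Returns.within {φ : Formula AP Var} {lev : Var → ℕ} {c : ℕ} {A A' : Aut P Γ AP Var E}
    {K : Set (State P Γ AP Var E)} (h0 : ∀ q : State P Γ AP Var E, q.level = 0 → q ∈ K)
    (hv : ∀ Z ∈ φ.free, ∀ p, .form p (.var Z) (lev Z) ∈ K) (hK : ∀ q ∈ K, q.level < c)
    (hA : A.Within K) (h : Returns M φ lev c A A') : A'.Within (K ∪ ownStates φ c) := by
  induction φ generalizing lev c A A' K with
  | atom x | natom x | var Z =>
    obtain rfl : A' = A := h
    exact hA.mono Set.subset_union_left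
  | and φ ψ ih₁ ih₂ =>
    obtain ⟨A₁, A₂, h₁, h₂, rfl⟩ := h
    have w₁ := (ih₁ h0 (fun Z hZ => hv Z (Or.inl hZ)) hK hA h₁).mono
      (show _ ⊆ K ∪ ownStates (.and φ ψ) c by simp only [ownStates]; grind)
    have w₂ := (ih₂ h0 (fun Z hZ => hv Z (Or.inr hZ)) hK hA h₂).mono
      (show _ ⊆ K ∪ ownStates (.and φ ψ) c by simp only [ownStates]; grind)
    rintro q a Q ((ht | ht) | ⟨p, a, Q₁, Q₂, h₁, h₂, he⟩)
    · exact w₁ q a Q ht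
    · exact w₂ q a Q ht
    · cases he
      exact ⟨Or.inr (Or.inl ⟨p, rfl⟩), Set.union_subset (w₁ _ _ _ h₁).2 (w₂ _ _ _ h₂).2⟩
  | or φ ψ ih₁ ih₂ =>
    obtain ⟨A₁, A₂, h₁, h₂, rfl⟩ := h
    have w₁ := (ih₁ h0 (fun Z hZ => hv Z (Or.inl hZ)) hK hA h₁).mono
      (show _ ⊆ K ∪ ownStates (.or φ ψ) c by simp only [ownStates]; grind)
    have w₂ := (ih₂ h0 (fun Z hZ => hv Z (Or.inr hZ)) hK hA h₂).mono
      (show _ ⊆ K ∪ ownStates (.or φ ψ) c by simp only [ownStates]; grind)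
    rintro q a Q ((ht | ht) | ⟨p, a, Q₁, ht, he⟩)
    · exact w₁ q a Q ht
    · exact w₂ q a Q ht
    · cases he
      exact ⟨Or.inr (Or.inl ⟨p, rfl⟩), ht.elim (fun h => (w₁ _ _ _ h).2) fun h => (w₂ _ _ _ h).2⟩
  | box φ ih =>
    obtain ⟨A₁, h₁, rfl⟩ := h
    have hsub : K ∪ ownStates φ c ⊆ K ∪ ownStates (.box φ) c := by simp only [ownStates]; grind
    have w₁ := (ih h0 hv hK hA h₁).mono hsub
    rintro q a Q (((ht | ⟨p, a, f, -, hf, he⟩) | ⟨p, a, -, -, he⟩) | ⟨p, -, he⟩)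
    · exact w₁ q a Q ht
    · cases he
      exact ⟨Or.inr (Or.inl ⟨p, rfl⟩), Set.iUnion₂_subset fun x hx =>
        w₁.run_subset (hsub (init_mem lev c φ _ h0 hv)) (hf x hx)⟩
    · cases he
      exact ⟨Or.inr (Or.inl ⟨p, rfl⟩), Set.singleton_subset_iff.2 (Or.inl (h0 _ rfl))⟩
    · cases he
      exact ⟨Or.inr (Or.inl ⟨p, rfl⟩), Set.singleton_subset_iff.2 (Or.inl (h0 _ rfl))⟩
  | dia φ ih =>
    obtain ⟨A₁, h₁, rfl⟩ := h
    have hsub : K ∪ ownStates φ c ⊆ K ∪ ownStates (.dia φ) c := by simp only [ownStates]; grind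
    have w₁ := (ih h0 hv hK hA h₁).mono hsub
    rintro q a Q (ht | ⟨p, a, Q, x, -, hr, he⟩)
    · exact w₁ q a Q ht
    · cases he
      exact ⟨Or.inr (Or.inl ⟨p, rfl⟩), w₁.run_subset (hsub (init_mem lev c φ _ h0 hv)) hr⟩
  | bbox φ ih =>
    obtain ⟨A₁, h₁, rfl⟩ := h
    have hsub : K ∪ ownStates φ c ⊆ K ∪ ownStates (.bbox φ) c := by simp only [ownStates]; grind
    have w₁ := (ih h0 hv hK hA h₁).mono hsub
    have hrun : ∀ {p u Q}, A₁.Run (init lev c φ p) u Q → Q ⊆ K ∪ ownStates (.bbox φ) c :=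
      fun hr => w₁.run_subset (hsub (init_mem lev c φ _ h0 hv)) hr
    have hform : ∀ p, (.form p (.bbox φ) c : State P Γ AP Var E) ∈ K ∪ ownStates (.bbox φ) c :=
      fun p => Or.inr (Or.inl (Or.inl ⟨p, rfl⟩))
    have hint : ∀ p a, (.int p (.bbox φ) c a : State P Γ AP Var E) ∈ K ∪ ownStates (.bbox φ) c :=
      fun p a => Or.inr (Or.inl (Or.inr ⟨p, a, rfl⟩))
    have hzero : ∀ q : State P Γ AP Var E, q.level = 0 → {q} ⊆ K ∪ ownStates (.bbox φ) c :=
      fun q hq => Set.singleton_subset_iff.2 (Or.inl (h0 q hq))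
    rintro q a Q ((((((ht | ⟨p, a, f, g, hf, hg, he⟩) | ⟨p, a, b, f, -, -, hf, he⟩) |
      ⟨p, a, -, -, he⟩) | ⟨p, -, he⟩) | ⟨p, a, b, -, -, -, he⟩) | ⟨p, a, -, -, he⟩)
    · exact w₁ q a Q ht
    all_goals cases he
    · refine ⟨hform p, Set.union_subset (Set.union_subset ?_ ?_) ?_⟩
      · rw [Set.singleton_subset_iff, intState]
        split_ifs
        exacts [Or.inl (h0 _ rfl), hint p _]
      · exact Set.iUnion₂_subset fun x hx => hrun (hf x hx)
      · exact Set.iUnion₂_subset fun x hx => hrun (hg x hx)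
    · exact ⟨hint p a, Set.iUnion₂_subset fun x hx => hrun (hf x hx)⟩
    · exact ⟨hform p, hzero _ rfl⟩
    · exact ⟨hform p, hzero _ rfl⟩
    · exact ⟨hint p a, hzero _ rfl⟩
    · exact ⟨hint p a, hzero _ rfl⟩
  | bdia φ ih =>
    obtain ⟨A₁, h₁, rfl⟩ := h
    have hsub : K ∪ ownStates φ c ⊆ K ∪ ownStates (.bdia φ) c := by simp only [ownStates]; grind
    have w₁ := (ih h0 hv hK hA h₁).mono hsub
    have hrun : ∀ {p u Q}, A₁.Run (init lev c φ p) u Q → Q ⊆ K ∪ ownStates (.bdia φ) c :=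
      fun hr => w₁.run_subset (hsub (init_mem lev c φ _ h0 hv)) hr
    have hform : ∀ p, (.form p (.bdia φ) c : State P Γ AP Var E) ∈ K ∪ ownStates (.bdia φ) c :=
      fun p => Or.inr (Or.inl (Or.inl ⟨p, rfl⟩))
    have hint : ∀ p a, (.int p (.bdia φ) c a : State P Γ AP Var E) ∈ K ∪ ownStates (.bdia φ) c :=
      fun p a => Or.inr (Or.inl (Or.inr ⟨p, a, rfl⟩))
    rintro q a Q ((((ht | ⟨p, a, Q, x, -, hr, he⟩) | ⟨p, a, Q, x, -, hr, he⟩) |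
      ⟨p, a, -, he⟩) | ⟨p, a, b, Q, -, x, -, hr, he⟩)
    · exact w₁ q a Q ht
    all_goals cases he
    · exact ⟨hform p, hrun hr⟩
    · exact ⟨hform p, hrun hr⟩
    · exact ⟨hform p, Set.singleton_subset_iff.2 (hint p _)⟩
    · exact ⟨hint p a, hrun hr⟩
  | mu Z φ ih | nu Z φ ih =>
    obtain ⟨n, As, Bs, hA0, hs, -, -, rfl⟩ := h
    have hK' : ∀ q ∈ K ∪ (formStates (.var Z) c ∪ ownStates φ c), q.level < c + 1 := by
      rintro q (hq | ⟨p, rfl⟩ | hq)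
      · exact (hK q hq).trans (Nat.lt_succ_self c)
      · exact Nat.lt_succ_self c
      · exact (level_of_mem_ownStates hq).trans_lt (Nat.lt_succ_self c)
    have hv' : ∀ z ∈ φ.free, ∀ p, .form p (.var z) (Function.update lev Z c z) ∈
        K ∪ (formStates (.var Z) c ∪ ownStates φ c) := by
      intro z hz p
      by_cases hzZ : z = Z
      · subst hzZ
        exact Or.inr (Or.inl ⟨p, by simp⟩)
      · rw [Function.update_of_ne hzZ]
        exact Or.inl (hv z ⟨hz, hzZ⟩ p)
    refine loop_within hK hA (fun X Y hX hXY => ?_) ?_ hs (n + 1) le_rfl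
    · exact ih (fun q hq => Or.inl (h0 q hq)) hv' hK' hX hXY
    · rw [hA0]
      first
        | exact muStart_within hA
        | exact nuStart_within h0 hA


lemma Returns.final_eq {φ : Formula AP Var} {lev : Var → ℕ} {c : ℕ} {A A' : Aut P Γ AP Var E}
    (h : Returns M φ lev c A A') : A'.final = A.final := by
  induction φ generalizing lev c A A' with
  | atom x | natom x | var Z => exact congrArg _ h
  | and φ ψ ih₁ ih₂ | or φ ψ ih₁ ih₂ =>
    obtain ⟨A₁, A₂, h₁, h₂, rfl⟩ := h
    exact (congrArg₂ _ (ih₁ h₁) (ih₂ h₂)).trans (Set.union_self _)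
  | box φ ih | dia φ ih | bbox φ ih | bdia φ ih =>
    obtain ⟨A₁, h₁, rfl⟩ := h
    have := ih h₁
    exact this
  | mu Z φ ih | nu Z φ ih =>
    obtain ⟨n, As, Bs, -, hs, -, -, rfl⟩ := h
    rw [(hs n le_rfl).2]
    rfl

end Automata

/-! ### Stacks along transitions -/

section Stacks

variable {P Γ : Type*} {M : PDS P Γ}

lemma PDS.cons_bot_mem_stackWords {w : List Γ} : M.bot :: w ∈ M.stackWords ↔ w = [] := by
  constructor
  · rintro ⟨v, hv, hb⟩
    cases v with
    | nil => simpa using hv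
    | cons b v => simp_all
  · rintro rfl
    exact ⟨[], rfl, by simp⟩

lemma PDS.cons_mem_stackWords {a : Γ} {w : List Γ} (ha : a ≠ M.bot) :
    a :: w ∈ M.stackWords ↔ w ∈ M.stackWords := by
  constructor
  · rintro ⟨v, hv, hb⟩
    cases v with
    | nil => simp_all
    | cons b v =>
      simp only [List.cons_append, List.cons.injEq] at hv
      exact ⟨v, hv.2, fun h => hb (List.mem_cons_of_mem _ h)⟩
  · rintro ⟨v, rfl, hb⟩
    exact ⟨a :: v, rfl, by simp [hb, ha.symm]⟩

lemma PDS.append_mem_stackWords {u w : List Γ} (hu : M.bot ∉ u) :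
    u ++ w ∈ M.stackWords ↔ w ∈ M.stackWords := by
  induction u with
  | nil => rfl
  | cons a u ih =>
    simp only [List.mem_cons, not_or] at hu
    rw [List.cons_append, PDS.cons_mem_stackWords (Ne.symm hu.1), ih hu.2]

/-- A command keeps its stack a stack, and makes stacks from stacks only. -/
lemma PDS.stackWords_rule {p p' : P} {a : Γ} {u w : List Γ} (h : (p, a, p', u) ∈ M.rules) :
    a :: w ∈ M.stackWords ↔ u ++ w ∈ M.stackWords := by
  by_cases ha : a = M.bot
  · subst ha
    obtain ⟨v, rfl, hv⟩ := M.bot_kept _ _ _ h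
    rw [PDS.cons_bot_mem_stackWords, List.append_assoc, PDS.append_mem_stackWords hv,
      List.singleton_append, PDS.cons_bot_mem_stackWords]
  · rw [PDS.cons_mem_stackWords ha, PDS.append_mem_stackWords (M.bot_not_made _ _ _ _ h ha)]

/-- The predecessors of a configuration, sorted by the three kinds of commands. -/
lemma PDS.step_cons_iff {p : P} {a : Γ} {w : List Γ} {k : P × List Γ} :
    M.Step k (p, a :: w) ↔
      (∃ x ∈ M.prePop p, k = (x.1, x.2 :: a :: w)) ∨ (∃ x ∈ M.preRew p a, k = (x.1, x.2 :: w)) ∨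
        ∃ b v, w = b :: v ∧ ∃ x ∈ M.prePush p a b, k = (x.1, x.2 :: v) := by
  constructor
  · obtain ⟨p', k⟩ := k
    rintro ⟨a', u, v, hr, hk, hu⟩
    simp only at hr hk hu
    subst hk
    match u, M.short _ _ _ _ hr, hr, hu with
    | [], _, hr, hu => exact Or.inl ⟨(p', a'), hr, by simp_all⟩
    | [b], _, hr, hu =>
      obtain ⟨rfl, rfl⟩ := List.cons.inj hu
      exact Or.inr (Or.inl ⟨(p', a'), hr, rfl⟩)
    | [b, d], _, hr, hu =>
      obtain ⟨rfl, rfl⟩ := List.cons.inj hu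
      exact Or.inr (Or.inr ⟨d, v, rfl, (p', a'), hr, rfl⟩)
    | _ :: _ :: _ :: _, hs, _, _ => simp at hs
  · rintro (⟨x, hx, rfl⟩ | ⟨x, hx, rfl⟩ | ⟨b, v, rfl, x, hx, rfl⟩)
    · exact ⟨x.2, [], a :: w, hx, rfl, rfl⟩
    · exact ⟨x.2, [a], w, hx, rfl, rfl⟩
    · exact ⟨x.2, [a, b], v, hx, rfl, rfl⟩

end Stacks

/-! ### Soundness for the connectives -/

section Core

variable {P Γ AP Var E : Type*} [DecidableEq Var]

/-- `W` is a valuation of the automaton states as it should be during a call at level `c` where the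
variables, free and bound, have the values `U`, and those in `X` are in scope. -/
structure Adequate (M : PDS P Γ) (ρ : AP → Set (P × List Γ)) (X : Set Var) (lev : Var → ℕ) (c : ℕ)
    (U : Var → Set (P × List Γ)) (W : State P Γ AP Var E → Set (List Γ)) : Prop where
  pos : 0 < c
  configs : ∀ Z, U Z ⊆ M.configs
  rep : Represents M ρ U X lev W
  lev_lt : ∀ Z ∈ X, lev Z < c
  canon : ∀ q, c ≤ q.level → W q = canonVal M ρ U q

variable {M : PDS P Γ} {ρ : AP → Set (P × List Γ)}

lemma Adequate.mono {X Y : Set Var} {lev : Var → ℕ} {c : ℕ} {U : Var → Set (P × List Γ)}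
    {W : State P Γ AP Var E → Set (List Γ)} (h : Adequate M ρ X lev c U W) (hY : Y ⊆ X) :
    Adequate M ρ Y lev c U W :=
  { h with
    rep := { h.rep with var := fun p Z hZ => h.rep.var p Z (hY hZ) }
    lev_lt := fun Z hZ => h.lev_lt Z (hY hZ) }

lemma Adequate.form {X : Set Var} {lev : Var → ℕ} {c : ℕ} {U : Var → Set (P × List Γ)}
    {W : State P Γ AP Var E → Set (List Γ)} (h : Adequate M ρ X lev c U W) (p : P)
    (φ : Formula AP Var) : W (.form p φ c) = {w | (p, w) ∈ den M ρ U φ} :=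
  h.canon _ le_rfl

lemma Adequate.init_eq {φ : Formula AP Var} {lev : Var → ℕ} {c : ℕ} {U : Var → Set (P × List Γ)}
    {W : State P Γ AP Var E → Set (List Γ)} (h : Adequate M ρ φ.free lev c U W)
    (hU : FixCompat M ρ U φ) (p : P) : W (init lev c φ p) = {w | (p, w) ∈ den M ρ U φ} := by
  cases φ with
  | atom x => exact h.rep.atom p x
  | natom x => exact h.rep.natom p x
  | var Z => exact h.rep.var p Z rfl
  | and φ ψ | or φ ψ | box φ | dia φ | bbox φ | bdia φ => exact h.form p _
  | mu Z φ | nu Z φ => rw [← hU.1]; exact h.form p (.var Z)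

/-- The algorithm for `φ` preserves soundness. -/
def PreservesSound (E : Type*) (M : PDS P Γ) (ρ : AP → Set (P × List Γ)) (φ : Formula AP Var) :
    Prop :=
  ∀ (lev : Var → ℕ) (c : ℕ) (U : Var → Set (P × List Γ)) (W : State P Γ AP Var E → Set (List Γ))
    (A A' : Aut P Γ AP Var E), Adequate M ρ φ.free lev c U W → FixCompat M ρ U φ →
      A.Within {q | q.level < c} → Sound W A → Returns M φ lev c A A' → Sound W A'

variable {lev : Var → ℕ} {c : ℕ} {U : Var → Set (P × List Γ)}
  {W : State P Γ AP Var E → Set (List Γ)} {A A₁ A₂ : Aut P Γ AP Var E} {φ ψ : Formula AP Var}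

lemma sound_andAut (hW : Adequate M ρ (Formula.and φ ψ).free lev c U W)
    (hU : FixCompat M ρ U (.and φ ψ)) (h₁ : Sound W A₁) (h₂ : Sound W A₂) :
    Sound W (andAut c φ ψ A₁ A₂ (init lev c φ) (init lev c ψ)) := by
  rintro q a Q ((ht | ht) | ⟨p, a, Q₁, Q₂, ht₁, ht₂, he⟩) w hw
  · exact h₁ q a Q ht w hw
  · exact h₂ q a Q ht w hw
  · cases he
    have hd₁ := h₁ _ _ _ ht₁ w fun q hq => hw q (Or.inl hq)
    have hd₂ := h₂ _ _ _ ht₂ w fun q hq => hw q (Or.inr hq)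
    rw [(hW.mono Set.subset_union_left).init_eq hU.1] at hd₁
    rw [(hW.mono Set.subset_union_right).init_eq hU.2] at hd₂
    rw [hW.form]
    exact ⟨hd₁, hd₂⟩

lemma sound_orAut (hW : Adequate M ρ (Formula.or φ ψ).free lev c U W)
    (hU : FixCompat M ρ U (.or φ ψ)) (h₁ : Sound W A₁) (h₂ : Sound W A₂) :
    Sound W (orAut c φ ψ A₁ A₂ (init lev c φ) (init lev c ψ)) := by
  rintro q a Q ((ht | ht) | ⟨p, a, Q, ht | ht, he⟩) w hw
  · exact h₁ q a Q ht w hw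
  · exact h₂ q a Q ht w hw
  · cases he
    have hd := h₁ _ _ _ ht w hw
    rw [(hW.mono Set.subset_union_left).init_eq hU.1] at hd
    rw [hW.form]
    exact Or.inl hd
  · cases he
    have hd := h₂ _ _ _ ht w hw
    rw [(hW.mono Set.subset_union_right).init_eq hU.2] at hd
    rw [hW.form]
    exact Or.inr hd

lemma mem_den_of_run (hW : Adequate M ρ φ.free lev c U W) (hU : FixCompat M ρ U φ)
    (h : Sound W A) {p : P} {u w : List Γ} {Q : Set (State P Γ AP Var E)}
    (hr : A.Run (init lev c φ p) u Q) (hw : ∀ q ∈ Q, w ∈ W q) : (p, u ++ w) ∈ den M ρ U φ := by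
  have := h.run hr hw
  rwa [hW.init_eq hU] at this

lemma sound_boxAut (hρ : ∀ x, ρ x ⊆ M.configs) (hW : Adequate M ρ φ.free lev c U W)
    (hU : FixCompat M ρ U φ) (h : Sound W A) : Sound W (boxAut M c φ A (init lev c φ)) := by
  rintro q a Q (((ht | ⟨p, a, f, ⟨y, hy⟩, hf, he⟩) | ⟨p, a, ha, hn, he⟩) | ⟨p, hn, he⟩) w hw
  · exact h q a Q ht w hw
  all_goals
    cases he
    rw [hW.form]
  · have hd : ∀ x ∈ M.next p a, (x.1, x.2 ++ w) ∈ den M ρ U φ := fun x hx =>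
      mem_den_of_run hW hU h (hf x hx) fun q hq => hw q (Set.mem_biUnion hx hq)
    refine ⟨(PDS.stackWords_rule hy).2 (den_subset_configs hρ φ hW.configs (hd y hy)), ?_⟩
    rintro ⟨p', k⟩ - ⟨b, u, v, hr, hk, hu⟩
    obtain ⟨rfl, rfl⟩ := List.cons.inj hk
    obtain rfl : k = u ++ w := hu
    exact hd (p', u) hr
  · refine ⟨(PDS.cons_mem_stackWords ha).2 (hW.rep.top ▸ hw _ rfl), ?_⟩
    rintro ⟨p', k⟩ - ⟨b, u, v, hr, hk, hu⟩
    obtain ⟨rfl, rfl⟩ := List.cons.inj hk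
    exact (Set.eq_empty_iff_forall_notMem.1 hn (p', u) hr).elim
  · have hw : w ∈ W .fin := hw _ rfl
    rw [hW.rep.fin] at hw
    refine ⟨PDS.cons_bot_mem_stackWords.2 hw, ?_⟩
    rintro ⟨p', k⟩ - ⟨b, u, v, hr, hk, hu⟩
    obtain ⟨rfl, rfl⟩ := List.cons.inj hk
    exact (Set.eq_empty_iff_forall_notMem.1 hn (p', u) hr).elim

lemma sound_diaAut (hρ : ∀ x, ρ x ⊆ M.configs) (hW : Adequate M ρ φ.free lev c U W)
    (hU : FixCompat M ρ U φ) (h : Sound W A) : Sound W (diaAut M c φ A (init lev c φ)) := by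
  rintro q a Q (ht | ⟨p, a, Q, x, hx, hr, he⟩) w hw
  · exact h q a Q ht w hw
  cases he
  rw [hW.form]
  have hd := mem_den_of_run hW hU h hr hw
  have hc := den_subset_configs hρ φ hW.configs hd
  exact ⟨(PDS.stackWords_rule hx).2 hc, _, hc, ⟨a, x.2, w, hx, rfl, rfl⟩, hd⟩

lemma sound_bboxAut (hρ : ∀ x, ρ x ⊆ M.configs) (hW : Adequate M ρ φ.free lev c U W)
    (hU : FixCompat M ρ U φ) (h : Sound W A) : Sound W (bboxAut M c φ A (init lev c φ)) := by
  have hint : ∀ p a, W (.int p (.bbox φ) c a) = allPush M (den M ρ U φ) p a :=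
    fun p a => hW.canon (.int p (.bbox φ) c a) le_rfl
  have hbot : ∀ {w}, w ∈ W .fin → w = [] := fun hw => by rwa [hW.rep.fin] at hw
  have hcfg := den_subset_configs hρ φ hW.configs
  rintro q a Q ((((((ht | ⟨p, a, f, g, hf, hg, he⟩) | ⟨p, a, b, f, ha, ⟨y, hy⟩, hf, he⟩) |
    ⟨p, a, ha, hn, he⟩) | ⟨p, hn, he⟩) | ⟨p, a, b, ha, hb, hn, he⟩) | ⟨p, a, ha, hn, he⟩) w hw
  · exact h q a Q ht w hw
  all_goals cases he
  · have hi := hw _ (Or.inl (Or.inl rfl))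
    have hstack : a :: w ∈ M.stackWords := by
      by_cases ha : a = M.bot
      · rw [intState, if_pos ha] at hi
        rw [ha, PDS.cons_bot_mem_stackWords, hbot hi]
      · rw [intState, if_neg ha, hint] at hi
        exact (PDS.cons_mem_stackWords ha).2 hi.1
    rw [hW.form]
    refine ⟨hstack, fun k _ hk => ?_⟩
    rcases PDS.step_cons_iff.1 hk with ⟨x, hx, rfl⟩ | ⟨x, hx, rfl⟩ | ⟨b, v, rfl, x, hx, rfl⟩
    · exact mem_den_of_run hW hU h (hf x hx) fun q hq =>
        hw q (Or.inl (Or.inr (Set.mem_biUnion hx hq)))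
    · exact mem_den_of_run hW hU h (hg x hx) fun q hq => hw q (Or.inr (Set.mem_biUnion hx hq))
    · have ha : a ≠ M.bot := by
        rintro rfl
        exact List.cons_ne_nil _ _ (PDS.cons_bot_mem_stackWords.1 hstack)
      rw [intState, if_neg ha, hint] at hi
      exact hi.2 b v rfl x hx
  -- The second letter that is read, below the letter `a` of the source state.
  · rename_i b
    have hd : ∀ x ∈ M.prePush p a b, (x.1, x.2 :: w) ∈ den M ρ U φ := fun x hx =>
      mem_den_of_run hW hU h (hf x hx) fun q hq => hw q (Set.mem_biUnion hx hq)
    rw [hint]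
    refine ⟨?_, ?_⟩
    · exact (PDS.cons_mem_stackWords ha).1 ((PDS.stackWords_rule hy).1 (hcfg (hd y hy)))
    · rintro b' v he x hx
      obtain ⟨rfl, rfl⟩ := List.cons.inj he
      exact hd x hx
  · rw [hW.form]
    refine ⟨(PDS.cons_mem_stackWords ha).2 (hW.rep.top ▸ hw _ rfl), fun k _ hk => ?_⟩
    rcases PDS.step_cons_iff.1 hk with ⟨x, hx, rfl⟩ | ⟨x, hx, rfl⟩ | ⟨b, v, rfl, x, hx, rfl⟩
    · exact (Set.eq_empty_iff_forall_notMem.1 (hn a) x (Or.inl (Or.inl hx))).elim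
    · exact (Set.eq_empty_iff_forall_notMem.1 (hn a) x (Or.inl (Or.inr hx))).elim
    · exact (Set.eq_empty_iff_forall_notMem.1 (hn b) x (Or.inr hx)).elim
  · rw [hW.form]
    refine ⟨PDS.cons_bot_mem_stackWords.2 (hbot (hw _ rfl)), fun k _ hk => ?_⟩
    rcases PDS.step_cons_iff.1 hk with ⟨x, hx, rfl⟩ | ⟨x, hx, rfl⟩ | ⟨b, v, rfl, x, hx, rfl⟩
    · exact (Set.eq_empty_iff_forall_notMem.1 (hn M.bot) x (Or.inl (Or.inl hx))).elim
    · exact (Set.eq_empty_iff_forall_notMem.1 (hn M.bot) x (Or.inl (Or.inr hx))).elim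
    · exact (Set.eq_empty_iff_forall_notMem.1 (hn b) x (Or.inr hx)).elim
  · rw [hint]
    refine ⟨(PDS.cons_mem_stackWords hb).2 (hW.rep.top ▸ hw _ rfl), ?_⟩
    rintro b' v he x hx
    obtain ⟨rfl, rfl⟩ := List.cons.inj he
    exact (Set.eq_empty_iff_forall_notMem.1 hn x hx).elim
  · rw [hint]
    refine ⟨PDS.cons_bot_mem_stackWords.2 (hbot (hw _ rfl)), ?_⟩
    rintro b' v he x hx
    obtain ⟨rfl, rfl⟩ := List.cons.inj he
    exact (Set.eq_empty_iff_forall_notMem.1 hn x hx).elim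

lemma sound_bdiaAut (hρ : ∀ x, ρ x ⊆ M.configs) (hW : Adequate M ρ φ.free lev c U W)
    (hU : FixCompat M ρ U φ) (h : Sound W A) : Sound W (bdiaAut M c φ A (init lev c φ)) := by
  have hint : ∀ p a, W (.int p (.bdia φ) c a) = somePush M (den M ρ U φ) p a :=
    fun p a => hW.canon (.int p (.bdia φ) c a) le_rfl
  have hcfg := den_subset_configs hρ φ hW.configs
  rintro q a Q ((((ht | ⟨p, a, Q, x, hx, hr, he⟩) | ⟨p, a, Q, x, hx, hr, he⟩) |
    ⟨p, a, ha, he⟩) | ⟨p, a, b, Q, ha, x, hx, hr, he⟩) w hw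
  · exact h q a Q ht w hw
  all_goals cases he
  · have hd := mem_den_of_run hW hU h hr hw
    rw [hW.form]
    exact ⟨(PDS.stackWords_rule hx).1 (hcfg hd), _, hcfg hd,
      PDS.step_cons_iff.2 (Or.inl ⟨x, hx, rfl⟩), hd⟩
  · have hd := mem_den_of_run hW hU h hr hw
    rw [hW.form]
    exact ⟨(PDS.stackWords_rule hx).1 (hcfg hd), _, hcfg hd,
      PDS.step_cons_iff.2 (Or.inr (Or.inl ⟨x, hx, rfl⟩)), hd⟩
  · have hi := hw _ rfl
    rw [hint] at hi
    obtain ⟨hs, b, v, rfl, x, hx, hd⟩ := hi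
    rw [hW.form]
    exact ⟨(PDS.cons_mem_stackWords ha).2 hs, _, hcfg hd,
      PDS.step_cons_iff.2 (Or.inr (Or.inr ⟨b, v, rfl, x, hx, rfl⟩)), hd⟩
  -- The second letter that is read, below the letter `a` of the source state.
  · rename_i b
    have hd := mem_den_of_run hW hU h hr hw
    rw [hint]
    exact ⟨(PDS.cons_mem_stackWords ha).1 ((PDS.stackWords_rule hx).1 (hcfg hd)),
      b, w, rfl, x, hx, hd⟩

end Core

/-! ### Rounds of a fixed-point computation -/

section FixedPoints

variable {P Γ AP Var E : Type*} [DecidableEq Var]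

/-- The valuation of the automaton states at level `c` where `(p, Z, c)` stands for `S`, while the
other states of level `c` have the values that a round computes if `Z` stands for `S'`. Below
level `c`, it is `W`. -/
noncomputable def approxVal (M : PDS P Γ) (ρ : AP → Set (P × List Γ)) (φ : Formula AP Var)
    (Z : Var) (c : ℕ) (U : Var → Set (P × List Γ)) (W : State P Γ AP Var E → Set (List Γ))
    (S' S : Set (P × List Γ)) : State P Γ AP Var E → Set (List Γ) :=
  setForm (.var Z) c S fun q =>
    if q.level < c then W q else canonVal M ρ (fixExt M ρ φ (Function.update U Z S')) q

variable {M : PDS P Γ} {ρ : AP → Set (P × List Γ)} {φ : Formula AP Var} {Z : Var} {c : ℕ}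
  {lev : Var → ℕ} {U : Var → Set (P × List Γ)} {W : State P Γ AP Var E → Set (List Γ)}
  {S S' : Set (P × List Γ)} {q : State P Γ AP Var E}

lemma approxVal_var (p : P) :
    approxVal M ρ φ Z c U W S' S (.form p (.var Z) c) = {w | (p, w) ∈ S} :=
  setForm_self p

lemma approxVal_of_lt (hq : q.level < c) : approxVal M ρ φ Z c U W S' S q = W q := by
  rw [approxVal, setForm_of_ne fun h => hq.ne (level_of_mem_formStates h), if_pos hq]

lemma approxVal_of_le (hq : c ≤ q.level)
    (hf : q ∉ (formStates (.var Z) c : Set (State P Γ AP Var E))) :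
    approxVal M ρ φ Z c U W S' S q =
      canonVal M ρ (fixExt M ρ φ (Function.update U Z S')) q := by
  rw [approxVal, setForm_of_ne hf, if_neg hq.not_gt]

lemma approxVal_self_of_le (hZ : Z ∉ φ.bound) (hq : c ≤ q.level) :
    approxVal M ρ φ Z c U W S S q =
      canonVal M ρ (fixExt M ρ φ (Function.update U Z S)) q := by
  by_cases hf : q ∈ formStates (.var Z) c
  · obtain ⟨p, rfl⟩ := hf
    simp only [approxVal_var, canonVal, den, fixExt_of_notMem φ _ hZ, Function.update_self]
  · exact approxVal_of_le hq hf

lemma approxVal_mono {R R' : Set (P × List Γ)} (h' : S' ⊆ R') (h : S ⊆ R) :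
    approxVal M ρ φ Z c U W S' S ≤ approxVal M ρ φ Z c U W R' R := by
  intro q
  rcases lt_or_ge q.level c with hq | hq
  · rw [approxVal_of_lt hq, approxVal_of_lt hq]
  by_cases hf : q ∈ formStates (.var Z) c
  · obtain ⟨p, rfl⟩ := hf
    rw [approxVal_var, approxVal_var]
    exact fun w hw => h hw
  · rw [approxVal_of_le hq hf, approxVal_of_le hq hf]
    exact canonVal_mono (fixExt_mono φ (update_le_update_iff.2 ⟨h', fun _ _ => le_rfl⟩)) q

lemma approxVal_subset_stackWords (hρ : ∀ x, ρ x ⊆ M.configs) {X : Set Var}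
    (hW : Adequate M ρ X lev c U W) (hS' : S' ⊆ M.configs) (hS : S ⊆ M.configs) (hq : q ≠ .fin) :
    approxVal M ρ φ Z c U W S' S q ⊆ M.stackWords := by
  rcases lt_or_ge q.level c with hc | hc
  · rw [approxVal_of_lt hc]
    exact hW.rep.sub q hq
  by_cases hf : q ∈ formStates (.var Z) c
  · obtain ⟨p, rfl⟩ := hf
    rw [approxVal_var]
    exact fun w hw => hS hw
  · rw [approxVal_of_le hc hf]
    exact canonVal_subset_stackWords hρ
      (fixExt_subset_configs hρ φ (update_le_configs hW.configs Z hS')) q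

/-- If `U` interprets the bound variables of the body, the approximation where `Z` stands for `U Z`
is the given valuation. -/
lemma approxVal_fixpoint {X : Set Var} (hW : Adequate M ρ X lev c U W) (hU : FixCompat M ρ U φ) :
    approxVal M ρ φ Z c U W (U Z) (U Z) = W := by
  funext q
  rcases lt_or_ge q.level c with hq | hq
  · exact approxVal_of_lt hq
  by_cases hf : q ∈ formStates (.var Z) c
  · obtain ⟨p, rfl⟩ := hf
    rw [approxVal_var, hW.form]
    rfl
  · rw [approxVal_of_le hq hf, Function.update_eq_self, fixExt_eq_self hU, hW.canon q hq]

lemma den_fixExt (hφ : φ.WellNamed) (V : Var → Set (P × List Γ)) :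
    den M ρ (fixExt M ρ φ V) φ = den M ρ V φ :=
  den_congr φ fun _ hz => fixExt_of_notMem φ _ (Set.disjoint_left.1 hφ.disjoint_free_bound hz)

/-- One round. If the input automaton `B₀` is sound for `X`, where `Z` stands for `S`, then the
result is sound in a mixed sense: if `w` has the values that `X` and the denotations with `Z = S`
require in the target of a transition, then the value at its source is the denotation with `Z = S`,
and the states of `Z` itself get the denotation of the body. -/
lemma nextRound_step (hρ : ∀ x, ρ x ⊆ M.configs) (hφ : φ.WellNamed) (hZ : Z ∉ φ.bound)
    (ih : PreservesSound E M ρ φ) (hW : Adequate M ρ (φ.free \ {Z}) lev c U W)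
    {A B₀ B : Aut P Γ AP Var E} (hA : A.Within {q | q.level < c}) (hWA : Sound W A)
    {X : State P Γ AP Var E → Set (List Γ)} (hXW : ∀ q, q.level < c → X q = W q)
    (hXs : ∀ q, q ≠ .fin → X q ⊆ M.stackWords) (hS : S ⊆ M.configs)
    (hXS : ∀ p, X (.form p (.var Z) c) = {w | (p, w) ∈ S})
    (hB₀ : B₀.Within {q | q.level < c + 1}) (hXB₀ : Sound X B₀)
    (hB : Returns M φ (Function.update lev Z c) (c + 1) B₀ B)
    {q : State P Γ AP Var E} {a : Γ} {Q : Set (State P Γ AP Var E)}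
    (ht : (q, a, Q) ∈ (nextRound c Z A B (init (Function.update lev Z c) (c + 1) φ)).trans)
    {w : List Γ} (hX : ∀ q' ∈ Q, w ∈ X q')
    (hw : ∀ q' ∈ Q, w ∈ approxVal M ρ φ Z c U W S S q') :
    a :: w ∈ approxVal M ρ φ Z c U W S (den M ρ (Function.update U Z S) φ) q := by
  set US := fixExt M ρ φ (Function.update U Z S) with hUS
  have hUSc : ∀ z, US z ⊆ M.configs :=
    fixExt_subset_configs hρ φ (update_le_configs hW.configs Z hS)
  have hUSfree : ∀ z ∈ φ.free, US z = Function.update U Z S z := fun z hz =>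
    fixExt_of_notMem φ _ (Set.disjoint_left.1 hφ.disjoint_free_bound hz)
  -- The valuation for the recursive call at level `c + 1`.
  set Y : State P Γ AP Var E → Set (List Γ) :=
    fun q => if q.level < c + 1 then X q else canonVal M ρ US q with hY
  have hYlt : ∀ q, q.level < c + 1 → Y q = X q := fun q hq => if_pos hq
  have hYge : ∀ q, c + 1 ≤ q.level → Y q = canonVal M ρ US q := fun q hq => if_neg hq.not_gt
  have hYW : ∀ q, q.level < c → Y q = W q := fun q hq => (hYlt q (by lia)).trans (hXW q hq)
  have hYad : Adequate M ρ φ.free (Function.update lev Z c) (c + 1) US Y := by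
    refine ⟨by lia, hUSc, ⟨?_, ?_, ?_, ?_, ?_, ?_⟩, ?_, hYge⟩
    · rw [hYW .top hW.pos, hW.rep.top]
    · rw [hYW .fin hW.pos, hW.rep.fin]
    · intro q hq
      rcases lt_or_ge q.level (c + 1) with h | h
      · rw [hYlt q h]
        exact hXs q hq
      · rw [hYge q h]
        exact canonVal_subset_stackWords hρ hUSc q
    · exact fun p x => by rw [hYW (.form p (.atom x) 0) hW.pos, hW.rep.atom]
    · exact fun p x => by rw [hYW (.form p (.natom x) 0) hW.pos, hW.rep.natom]
    · intro p z hz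
      rw [hUSfree z hz]
      by_cases hzZ : z = Z
      · subst hzZ
        rw [Function.update_self, Function.update_self,
          hYlt (.form p (.var z) c) (Nat.lt_succ_self c), hXS]
      · rw [Function.update_of_ne hzZ, Function.update_of_ne hzZ,
          hYW (.form p (.var z) (lev z)) (hW.lev_lt z ⟨hz, hzZ⟩), hW.rep.var p z ⟨hz, hzZ⟩]
    · intro z hz
      by_cases hzZ : z = Z
      · subst hzZ
        simp
      · rw [Function.update_of_ne hzZ]
        exact (hW.lev_lt z ⟨hz, hzZ⟩).trans (Nat.lt_succ_self c)
  have hcompat : FixCompat M ρ US φ := fixCompat_fixExt hφ _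
  have hYB : Sound Y B := by
    refine ih _ _ US Y B₀ B hYad hcompat hB₀ (fun q a Q ht w hw => ?_) hB
    rw [hYlt q (hB₀ q a Q ht).1]
    exact hXB₀ q a Q ht w fun q' hq' => hYlt q' ((hB₀ q a Q ht).2 hq') ▸ hw q' hq'
  have hBw : B.Within ({q | q.level < c + 1} ∪ ownStates φ (c + 1)) := by
    refine Returns.within (fun q hq => ?_) (fun z hz p => ?_) (fun q hq => hq) hB₀ hB
    · exact hq.trans_lt (Nat.succ_pos c)
    · exact hYad.lev_lt z hz
  have hproj : ∀ q' ∈ ({q | q.level < c + 1} ∪ ownStates φ (c + 1) : Set (State P Γ AP Var E)),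
      w ∈ X (q'.proj c) → w ∈ approxVal M ρ φ Z c U W S S (q'.proj c) → w ∈ Y q' := by
    rintro q' (hq' | hq') h₁ h₂
    · rw [State.proj_eq_self (ne_of_lt hq')] at h₁
      rwa [hYlt q' hq']
    · have hl := level_of_mem_ownStates hq'
      rwa [hYge q' hl.ge, ← canonVal_proj c, hUS,
        ← approxVal_self_of_le (W := W) hZ (State.level_proj hl).ge]
  have hwY : ∀ q₀ b Q₀, (q₀, b, Q₀) ∈ B.trans → Q = State.proj c '' Q₀ → b :: w ∈ Y q₀ := by
    rintro q₀ b Q₀ hB' rfl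
    exact hYB q₀ b Q₀ hB' w fun q' hq' => hproj q' ((hBw _ _ _ hB').2 hq')
      (hX _ (Set.mem_image_of_mem _ hq')) (hw _ (Set.mem_image_of_mem _ hq'))
  rcases ht with (ht | ⟨q₀, a, Q₀, ht, hl, he⟩) | ⟨p, a, Q₀, ht, he⟩
  · obtain ⟨hq, hQ⟩ := hA q a Q ht
    rw [approxVal_of_lt hq]
    exact hWA q a Q ht w fun q' hq' => hXW q' (hQ hq') ▸ hX q' hq'
  · cases he
    have hmem := hwY _ _ _ ht rfl
    rw [hYge q₀ hl.ge] at hmem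
    have hown : q₀ ∈ ownStates φ (c + 1) :=
      (hBw _ _ _ ht).1.resolve_left fun h => (ne_of_lt h) hl
    rw [approxVal_of_le (State.level_proj hl).ge, canonVal_proj]
    · exact hmem
    -- The call does not create any state for `Z`, as `Z` is not bound in the body.
    · rintro ⟨p, hp⟩
      have := proj_mem_ownStates hown
      rw [hp] at this
      exact hZ (mem_bound_of_mem_ownStates this)
  · cases he
    have hmem := hwY _ _ _ ht rfl
    rw [hYad.init_eq hcompat, hUS, den_fixExt hφ] at hmem
    rwa [approxVal_var]

/-! ### Soundness for fixed points -/

lemma loop_level_lt {A : Aut P Γ AP Var E} (hW : Adequate M ρ (φ.free \ {Z}) lev c U W)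
    (hA : A.Within {q | q.level < c}) {As Bs : ℕ → Aut P Γ AP Var E} {n : ℕ}
    (h0 : (As 0).Within ({q | q.level < c} ∪ (formStates (.var Z) c ∪ ownStates φ c)))
    (hs : ∀ i ≤ n, Returns M φ (Function.update lev Z c) (c + 1) (As i) (Bs i) ∧
      As (i + 1) = nextRound c Z A (Bs i) (init (Function.update lev Z c) (c + 1) φ)) :
    ∀ i ≤ n + 1, (As i).Within {q | q.level < c + 1} := by
  have hK : ∀ q ∈ ({q | q.level < c} ∪ (formStates (.var Z) c ∪ ownStates φ c) :
      Set (State P Γ AP Var E)), q.level < c + 1 := by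
    rintro q (hq | hq | hq)
    · exact Nat.lt_succ_of_lt hq
    · rw [level_of_mem_formStates hq]; exact Nat.lt_succ_self c
    · rw [level_of_mem_ownStates hq]; exact Nat.lt_succ_self c
  refine fun i hi => (loop_within (fun q hq => hq) hA (fun X Y hX hXY => ?_) h0 hs i hi).mono hK
  refine hXY.within (fun q hq => Or.inl (hq.trans_lt hW.pos)) (fun z hz p => ?_) hK hX
  by_cases hzZ : z = Z
  · subst hzZ
    exact Or.inr (Or.inl ⟨p, by simp⟩)
  · rw [Function.update_of_ne hzZ]
    exact Or.inl (hW.lev_lt z ⟨hz, hzZ⟩)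

/-- For a least fixed point, soundness for the fixed point holds at the start and is preserved by
each round. -/
lemma preservesSound_mu (hρ : ∀ x, ρ x ⊆ M.configs) (hφ : φ.WellNamed) (hZ : Z ∉ φ.bound)
    (ih : PreservesSound E M ρ φ) : PreservesSound E M ρ (.mu Z φ) := by
  rintro lev c U W A A' hW hU hA hWA ⟨n, As, Bs, h0, hs, -, -, rfl⟩
  have hW : Adequate M ρ (φ.free \ {Z}) lev c U W := hW
  have hlt := loop_level_lt hW hA (by rw [h0]; exact muStart_within hA) hs
  have happ : approxVal M ρ φ Z c U W (U Z) (U Z) = W := approxVal_fixpoint hW hU.2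
  have key : ∀ i ≤ n + 1, Sound W (As i) := by
    intro i hi
    induction i with
    | zero => rw [h0]; exact hWA
    | succ i ihi =>
      obtain ⟨hr, he⟩ := hs i (by lia)
      rw [he]
      intro q a Q ht w hw
      have := nextRound_step hρ hφ hZ ih hW hA hWA (fun _ _ => rfl) hW.rep.sub (hW.configs Z)
        (fun p => hW.form p (.var Z)) (hlt i (by lia)) (ihi (by lia)) hr ht hw
        (by rwa [happ])
      rwa [Function.update_eq_self, hU.den_mu_body hρ hW.configs, happ] at this
  exact key _ le_rfl

/-- Each automaton of a greatest fixed-point loop is sound for some approximation of the fixed point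
from above. -/
lemma nu_loop_approx (hρ : ∀ x, ρ x ⊆ M.configs) (hφ : φ.WellNamed) (hZ : Z ∉ φ.bound)
    (ih : PreservesSound E M ρ φ) (hW : Adequate M ρ (φ.free \ {Z}) lev c U W)
    (hD : den M ρ U φ = U Z) {A : Aut P Γ AP Var E} (hA : A.Within {q | q.level < c})
    (hWA : Sound W A) {As Bs : ℕ → Aut P Γ AP Var E} {n : ℕ} (h0 : As 0 = nuStart M c Z A)
    (hlt : ∀ i ≤ n + 1, (As i).Within {q | q.level < c + 1})
    (hs : ∀ i ≤ n, Returns M φ (Function.update lev Z c) (c + 1) (As i) (Bs i) ∧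
      As (i + 1) = nextRound c Z A (Bs i) (init (Function.update lev Z c) (c + 1) φ)) :
    ∀ i ≤ n + 1, ∃ S' S, S ⊆ S' ∧ S' ⊆ M.configs ∧ U Z ⊆ S ∧
      den M ρ (Function.update U Z S') φ ⊆ S ∧ Sound (approxVal M ρ φ Z c U W S' S) (As i) := by
  intro i hi
  induction i with
  | zero =>
    refine ⟨M.configs, M.configs, subset_rfl, subset_rfl, hW.configs Z,
      den_subset_configs hρ φ (update_le_configs hW.configs Z subset_rfl), ?_⟩
    rw [h0]
    rintro q a Q ((ht | ⟨p, a, ha, he⟩) | ⟨p, he⟩) w hw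
    · obtain ⟨hq, hQ⟩ := hA q a Q ht
      rw [approxVal_of_lt hq]
      exact hWA q a Q ht w fun q' hq' => by
        simpa only [approxVal_of_lt (show q'.level < c from hQ hq')] using hw q' hq'
    · cases he
      have hw := hw _ rfl
      rw [approxVal_of_lt (q := .top) hW.pos, hW.rep.top] at hw
      rw [approxVal_var]
      exact (PDS.cons_mem_stackWords ha).2 hw
    · cases he
      have hw := hw _ rfl
      rw [approxVal_of_lt (q := .fin) hW.pos, hW.rep.fin] at hw
      rw [approxVal_var]
      exact PDS.cons_bot_mem_stackWords.2 hw
  | succ i ihi =>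
    obtain ⟨S', S, hSS', hS'c, hDS, hFS, hX⟩ := ihi (by lia)
    obtain ⟨hr, he⟩ := hs i (by lia)
    have hmono : ∀ {R R'}, R ⊆ R' → den M ρ (Function.update U Z R) φ ⊆
        den M ρ (Function.update U Z R') φ := fun h =>
      den_mono φ (update_le_update_iff.2 ⟨h, fun _ _ => le_rfl⟩)
    have hFS' : den M ρ (Function.update U Z S) φ ⊆ S := (hmono hSS').trans hFS
    have hSc := hSS'.trans hS'c
    refine ⟨S, den M ρ (Function.update U Z S) φ, hFS', hSc, ?_, subset_rfl, ?_⟩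
    · refine Eq.trans_subset ?_ (hmono hDS)
      rw [Function.update_eq_self, hD]
    rw [he]
    intro q a Q ht w hw
    exact nextRound_step hρ hφ hZ ih hW hA hWA (fun _ => approxVal_of_lt)
      (fun _ => approxVal_subset_stackWords hρ hW hS'c hSc) hSc approxVal_var (hlt i (by lia)) hX
      hr ht (fun q' hq' => approxVal_mono hSS' hFS' q' (hw q' hq'))
      fun q' hq' => approxVal_mono subset_rfl hFS' q' (hw q' hq')

/-- For a greatest fixed point, consider the automaton `A_n` where the loop stops, and the least
valuation above `W` for which it is sound. A further round leads to `A_{n+1}`, which is sound for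
the same valuations. So a round cannot make this least valuation smaller, which says that its value
of `Z` is a post-fixed point of the body. -/
lemma preservesSound_nu (hρ : ∀ x, ρ x ⊆ M.configs) (hφ : φ.WellNamed) (hZ : Z ∉ φ.bound)
    (ih : PreservesSound E M ρ φ) : PreservesSound E M ρ (.nu Z φ) := by
  rintro lev c U W A A' hW hU hA hWA ⟨n, As, Bs, h0, hs, hle₁, hle₂, rfl⟩
  have hW : Adequate M ρ (φ.free \ {Z}) lev c U W := hW
  have hlt := loop_level_lt hW hA
    (by rw [h0]; exact nuStart_within (fun q hq => hq.trans_lt hW.pos) hA) hs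
  have happ : approxVal M ρ φ Z c U W (U Z) (U Z) = W := approxVal_fixpoint hW hU.2
  have hD : den M ρ U φ = U Z := hU.den_nu_body hρ hW.configs
  let F : Set (State P Γ AP Var E → Set (List Γ)) :=
    {X | Sound X (As n) ∧ W ≤ X ∧ (∀ q, q.level < c → X q = W q) ∧
      ∀ q, q ≠ .fin → X q ⊆ M.stackWords}
  obtain ⟨X₀, hX₀⟩ : F.Nonempty := by
    obtain ⟨S', S, hSS', hS'c, hDS, -, hX⟩ :=
      nu_loop_approx hρ hφ hZ ih hW hD hA hWA h0 hlt hs n (Nat.le_succ n)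
    refine ⟨_, hX, ?_, fun _ => approxVal_of_lt,
      fun _ => approxVal_subset_stackWords hρ hW hS'c (hSS'.trans hS'c)⟩
    exact happ.ge.trans (approxVal_mono (hDS.trans hSS') hDS)
  let X : State P Γ AP Var E → Set (List Γ) := fun q => {w | ∀ Y ∈ F, w ∈ Y q}
  have hXs : Sound X (As n) := sound_sInter F fun Y hY => hY.1
  have hWX : W ≤ X := fun q w hw Y hY => hY.2.1 q hw
  have hXW : ∀ q, q.level < c → X q = W q := fun q hq =>
    Set.Subset.antisymm (fun w hw => hX₀.2.2.1 q hq ▸ hw X₀ hX₀) (hWX q)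
  have hXstack : ∀ q, q ≠ .fin → X q ⊆ M.stackWords := fun q hq w hw =>
    hX₀.2.2.2 q hq (hw X₀ hX₀)
  let S : Set (P × List Γ) := {k | k.2 ∈ X (.form k.1 (.var Z) c)}
  have hSc : S ⊆ M.configs := fun k hk => hXstack _ (by simp) hk
  have hDS : U Z ⊆ S := fun k hk => hWX _ (by rw [hW.form]; exact hk)
  -- What a further round makes of `X`.
  let Y : State P Γ AP Var E → Set (List Γ) := fun q =>
    X q ∩ approxVal M ρ φ Z c U W S (den M ρ (Function.update U Z S) φ) q
  have hDF : U Z ⊆ den M ρ (Function.update U Z S) φ := by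
    refine Eq.trans_subset hD.symm (den_mono φ ?_)
    exact le_update_iff.2 ⟨hDS, fun _ _ => le_rfl⟩
  have hYS : ∀ q, Y q ⊆ approxVal M ρ φ Z c U W S S q := by
    rintro q w ⟨h₁, h₂⟩
    by_cases hf : q ∈ formStates (.var Z) c
    · obtain ⟨p, rfl⟩ := hf
      rwa [approxVal_var]
    · rwa [approxVal, setForm_of_ne hf] at h₂ ⊢
  have hXtop : X .top = M.stackWords := (hXW .top hW.pos).trans hW.rep.top
  have hYF : Y ∈ F := by
    have hYlt : ∀ q, q.level < c → Y q = W q := fun q hq => by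
      simp only [Y, hXW q hq, approxVal_of_lt hq, Set.inter_self]
    have hYstack : ∀ q, q ≠ .fin → Y q ⊆ M.stackWords := fun q hq =>
      Set.inter_subset_left.trans (hXstack q hq)
    refine ⟨?_, fun q => Set.subset_inter (hWX q) ?_, hYlt, hYstack⟩
    · refine Sound.of_le ?_ hle₁ ((hYlt .top hW.pos).trans hW.rep.top) hYstack
      have hXs' : Sound X (As (n + 1)) := hXs.of_le hle₂ hXtop hXstack
      intro q a Q ht w hw
      refine ⟨hXs' q a Q ht w fun q' hq' => (hw q' hq').1, ?_⟩
      obtain ⟨hr, he⟩ := hs n le_rfl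
      rw [he] at ht
      exact nextRound_step hρ hφ hZ ih hW hA hWA hXW hXstack hSc (fun p => rfl)
        (hlt n (Nat.le_succ n)) hXs hr ht (fun q' hq' => (hw q' hq').1)
        fun q' hq' => hYS q' (hw q' hq')
    · exact (happ.ge.trans (approxVal_mono hDS hDF)) q
  have hXY : ∀ q, X q ⊆ Y q := fun q w hw => hw Y hYF
  have hSF : S ⊆ den M ρ (Function.update U Z S) φ := by
    rintro ⟨p, w⟩ hk
    have := (hXY _ hk).2
    rwa [approxVal_var] at this
  have hSD : S = U Z := by
    refine Set.Subset.antisymm ?_ hDS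
    rw [hU.1]
    exact Set.subset_sUnion_of_mem
      (S := {S | S ⊆ M.configs ∧ S ⊆ den M ρ (Function.update U Z S) φ}) ⟨hSc, hSF⟩
  have hXeq : X = W := by
    refine le_antisymm (fun q w hw => ?_) hWX
    have := hYS q (hXY q hw)
    rwa [hSD, happ] at this
  exact hXeq ▸ hXs.of_le hle₂ hXtop hXstack

lemma preservesSound (hρ : ∀ x, ρ x ⊆ M.configs) {φ : Formula AP Var} (hφ : φ.WellNamed) :
    PreservesSound E M ρ φ := by
  induction φ with
  | atom x | natom x | var Z =>
    rintro lev c U W A A' - - - hWA rfl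
    exact hWA
  | and φ ψ ih₁ ih₂ =>
    rintro lev c U W A A' hW hU hA hWA ⟨A₁, A₂, h₁, h₂, rfl⟩
    exact sound_andAut hW hU
      (ih₁ hφ.1 _ _ _ _ _ _ (hW.mono Set.subset_union_left) hU.1 hA hWA h₁)
      (ih₂ hφ.2.1 _ _ _ _ _ _ (hW.mono Set.subset_union_right) hU.2 hA hWA h₂)
  | or φ ψ ih₁ ih₂ =>
    rintro lev c U W A A' hW hU hA hWA ⟨A₁, A₂, h₁, h₂, rfl⟩
    exact sound_orAut hW hU
      (ih₁ hφ.1 _ _ _ _ _ _ (hW.mono Set.subset_union_left) hU.1 hA hWA h₁)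
      (ih₂ hφ.2.1 _ _ _ _ _ _ (hW.mono Set.subset_union_right) hU.2 hA hWA h₂)
  | box φ ih =>
    rintro lev c U W A A' hW hU hA hWA ⟨A₁, h₁, rfl⟩
    exact sound_boxAut hρ hW hU (ih hφ _ _ _ _ _ _ hW hU hA hWA h₁)
  | dia φ ih =>
    rintro lev c U W A A' hW hU hA hWA ⟨A₁, h₁, rfl⟩
    exact sound_diaAut hρ hW hU (ih hφ _ _ _ _ _ _ hW hU hA hWA h₁)
  | bbox φ ih =>
    rintro lev c U W A A' hW hU hA hWA ⟨A₁, h₁, rfl⟩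
    exact sound_bboxAut hρ hW hU (ih hφ _ _ _ _ _ _ hW hU hA hWA h₁)
  | bdia φ ih =>
    rintro lev c U W A A' hW hU hA hWA ⟨A₁, h₁, rfl⟩
    exact sound_bdiaAut hρ hW hU (ih hφ _ _ _ _ _ _ hW hU hA hWA h₁)
  | mu Z φ ih => exact preservesSound_mu hρ hφ.1 hφ.2 (ih hφ.1)
  | nu Z φ ih => exact preservesSound_nu hρ hφ.1 hφ.2 (ih hφ.1)

end FixedPoints

end BackMu

theorem lemma2 {P Γ AP Var E : Type*} [Finite P] [Finite Γ] [DecidableEq Var]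
    (M : PDS P Γ) (ρ : AP → Set (P × List Γ)) (hρ : ∀ x, ρ x ⊆ M.configs)
    (V : Var → Set (P × List Γ)) (hV : ∀ Z, V Z ⊆ M.configs)
    (φ : Formula AP Var) (hφ : φ.WellNamed)
    (c : ℕ) (lev : Var → ℕ) (hlev : ∀ Z ∈ φ.free, lev Z < c)
    (T : State P Γ AP Var E → Set (List Γ)) (hT : Represents M ρ V φ.free lev T)
    (A A' : Aut P Γ AP Var E) (hA : A.IsInput M c) (hsound : Sound T A)
    (hrun : Returns M φ lev c A A') :
    Sound (updVal M ρ c φ V T) A' ∧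
      (∀ p, updVal M ρ c φ V T (init lev c φ p) = {w | (p, w) ∈ den M ρ V φ}) ∧
      ∀ p w, A'.Accepts (init lev c φ p) w → (p, w) ∈ den M ρ V φ := by
  have hpos : 0 < c := hA.level_lt _ hA.top_mem
  have hAw : A.Within {q | q.level < c} := fun q a Q ht =>
    ⟨hA.level_lt q (hA.trans_mem q a Q ht).1,
      fun q' hq' => hA.level_lt q' ((hA.trans_mem q a Q ht).2 hq')⟩
  set U := fixExt M ρ φ V with hU
  have hUc : ∀ Z, U Z ⊆ M.configs := fixExt_subset_configs hρ φ hV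
  have hcompat : FixCompat M ρ U φ := fixCompat_fixExt hφ V
  have hVU : Set.EqOn V U φ.free := fun z hz =>
    (fixExt_of_notMem φ V (Set.disjoint_left.1 hφ.disjoint_free_bound hz)).symm
  -- This valuation differs from the updated valuation only at states that the algorithm does not use.
  let W : State P Γ AP Var E → Set (List Γ) := fun q =>
    if q.level < c then T q else canonVal M ρ U q
  have hWlt : ∀ q, q.level < c → W q = T q := fun q hq => if_pos hq
  have hWge : ∀ q, c ≤ q.level → W q = canonVal M ρ U q := fun q hq => if_neg hq.not_gt
  have hW : Adequate M ρ φ.free lev c U W := by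
    refine ⟨hpos, hUc, ⟨?_, ?_, fun q hq => ?_, fun p x => ?_, fun p x => ?_, fun p Z hZ => ?_⟩,
      hlev, hWge⟩
    · rw [hWlt .top hpos, hT.top]
    · rw [hWlt .fin hpos, hT.fin]
    · rcases lt_or_ge q.level c with h | h
      · rw [hWlt q h]
        exact hT.sub q hq
      · rw [hWge q h]
        exact canonVal_subset_stackWords hρ hUc q
    · rw [hWlt (.form p (.atom x) 0) hpos, hT.atom]
    · rw [hWlt (.form p (.natom x) 0) hpos, hT.natom]
    · rw [hWlt (.form p (.var Z) (lev Z)) (hlev Z hZ), hT.var p Z hZ, hVU hZ]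
  have hWupd : Set.EqOn W (updVal M ρ c φ V T) ({q | q.level < c} ∪ ownStates φ c) := by
    rintro q (hq | hq)
    · rw [hWlt q hq, updVal_of_notMem φ fun h => (ne_of_lt hq) (level_of_mem_ownStates h)]
    · rw [hWge q (level_of_mem_ownStates hq).ge, updVal_of_mem hcompat hVU hq]
  have hTW : Sound W A := hsound.congr hAw fun q hq => (hWlt q hq).symm
  have hA'w : A'.Within ({q | q.level < c} ∪ ownStates φ c) :=
    hrun.within (fun q hq => hq.trans_lt hpos) (fun Z hZ _ => hlev Z hZ) (fun q hq => hq) hAw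
  have hsound' : Sound (updVal M ρ c φ V T) A' :=
    (preservesSound hρ hφ _ _ _ _ _ _ hW hcompat hAw hTW hrun).congr hA'w hWupd
  have hinit : ∀ p, updVal M ρ c φ V T (init lev c φ p) = {w | (p, w) ∈ den M ρ V φ} := by
    intro p
    rw [← hWupd (init_mem lev c φ p (fun q hq => hq.trans_lt hpos) fun Z hZ _ => hlev Z hZ),
      hW.init_eq hcompat, den_congr φ hVU]
  refine ⟨hsound', hinit, fun p w ⟨Q, hr, hQ⟩ => ?_⟩
  have hfin : [] ∈ updVal M ρ c φ V T .fin := by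
    rw [← hWupd (Or.inl hpos), hW.rep.fin]
    rfl
  have hacc := hsound'.run hr (w := []) fun q hq => by
    have hq' := hQ hq
    rw [hrun.final_eq, hA.final_eq] at hq'
    exact (show q = .fin from hq') ▸ hfin
  rwa [List.append_nil, hinit p] at hacc
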